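/- Let $c>0$ and let $(z_k)_{k\ge 0}$ be a nondecreasing sequence of positive numbers with $z_k\to\infty$ and $z_k/z_{k-1}\to 1$ as $k\to\infty$. Let $(X_k)_{k\ge 1}$ be independent random variables with values in $\mathbb N_0=\{0,1,2,\dots\}$ such that, for all $k\ge 1$, $$q_k^0:=\mathbb P(X_k=0)=\left(\frac{z_{k-1}}{z_k}\right)^{c},\qquad q_k^1:=\mathbb P(X_k=1)=q_k^0(1-q_k^0).$$ For $n\ge 1$ let $\nu_n=\sum_{k\ge 1}X_k\,\delta_{z_k/z_n}$, a point process on $(0,\infty)$, and let $\eta_c$ be a Poisson process on $(0,\infty)$ with intensity measure $c\,t^{-1}\,dt$. Then $\nu_n\to\eta_c$ vaguely in distribution as $n\to\infty$; that is, $\nu_n$ converges to $\eta_c$ in distribution as random elements of the space of locally finite measures on $(0,\infty)$ equipped with the vague topology, the coarsest topology making $\mu\mapsto\int f\,d\mu$ continuous for every bounded non-negative continuous $f$ on $(0,\infty)$ with relatively compact support in $(0,\infty)$. If, in addition, $\mathbb E X_k=\mathcal O(q_k^1)$ as $k\to\infty$, then $$\frac1{z_n}\sum_{k=1}^n z_kX_k\longrightarrow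 D_c\quad\text{in distribution as } n\to\infty,$$ where $D_c$ has the generalized Dickman distribution with parameter $c$, i.e. the unique law of a non-negative random variable $W$ such that $Q^{1/c}(W+1)$ has the same distribution as $W$ when $Q$ is uniform on $[0,1]$ and independent of $W$. -/

import Mathlib

open MeasureTheory ProbabilityTheory Filter Topology Set
open scoped ENNReal NNReal CompactlySupported

/-- The space `M(S)` of locally finite non-negative Borel measures on `S`. (On a locally compact
space, locally finite means finite on relatively compact Borel sets.) -/
def LocFinMeasure (S : Type*) [TopologicalSpace S] [MeasurableSpace S] : Type _ :=
  {μ : Measure S // IsLocallyFiniteMeasure μ}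

/-- The vague topology: the coarsest topology on `M(S)` making `μ ↦ ∫ f dμ` continuous for every
non-negative (automatically bounded) continuous function `f` with relatively compact support. -/
noncomputable instance LocFinMeasure.vagueTopology (S : Type*) [TopologicalSpace S] [MeasurableSpace S] :
    TopologicalSpace (LocFinMeasure S) :=
  ⨅ f : C_c(S, ℝ≥0), TopologicalSpace.induced
    (fun μ : LocFinMeasure S => ∫ x, (f x : ℝ) ∂μ.1) inferInstance

/-- `M(S)` carries the Borel σ-algebra of the vague topology. -/
noncomputable instance LocFinMeasure.measurableSpace (S : Type*) [TopologicalSpace S] [MeasurableSpace S] :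
    MeasurableSpace (LocFinMeasure S) := borel _

instance LocFinMeasure.borelSpace (S : Type*) [TopologicalSpace S] [MeasurableSpace S] :
    BorelSpace (LocFinMeasure S) := ⟨rfl⟩

/-- `η` is a Poisson process on `S` with intensity measure `Λ`: all counts `η(B)` are random
variables, `η(B)` has the Poisson law with mean `Λ(B)` when `Λ(B) < ∞`, and the counts of
finitely many pairwise disjoint Borel sets are independent. -/
structure IsPoissonProcess {S Ω : Type*} [TopologicalSpace S] [MeasurableSpace S]
    [MeasurableSpace Ω] (η : Ω → LocFinMeasure S) (Λ : Measure S) (P : Measure Ω) : Prop where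
  measurable_count : ∀ B : Set S, MeasurableSet B → Measurable fun ω => (η ω).1 B
  poisson_count : ∀ B : Set S, MeasurableSet B → Λ B ≠ ∞ →
    P.map (fun ω => (η ω).1 B) =
      (poissonMeasure (Λ B).toNNReal).map (fun m : ℕ => (m : ℝ≥0∞))
  indep_count : ∀ (m : ℕ) (B : Fin m → Set S), (∀ i, MeasurableSet (B i)) →
    Pairwise (fun i j => Disjoint (B i) (B j)) → iIndepFun (fun i ω => (η ω).1 (B i)) P

/-- The measure `c t⁻¹ dt` on `(0, ∞)`. -/
noncomputable def scaleInvariantIntensity (c : ℝ) : Measure (Ioi (0 : ℝ)) :=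
  ((volume : Measure ℝ).comap Subtype.val).withDensity fun t => ENNReal.ofReal (c / (t : ℝ))

/-- The random measure obtained by placing mass `m k` at the point `w k` is locally finite if
the points `w k` tend to infinity. -/
theorem isLocallyFiniteMeasure_sum_dirac (w : ℕ → Ioi (0 : ℝ))
    (hw : Tendsto (fun k => (w k : ℝ)) atTop atTop) (m : ℕ → ℕ) :
    IsLocallyFiniteMeasure (Measure.sum fun k => (m k : ℝ≥0∞) • Measure.dirac (w k)) := by
  refine ⟨fun x => ?_⟩
  have hopen : IsOpen {y : Ioi (0 : ℝ) | (y : ℝ) < x + 1} :=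
    isOpen_lt continuous_subtype_val continuous_const
  refine ⟨{y : Ioi (0 : ℝ) | (y : ℝ) < x + 1}, hopen.mem_nhds (by simp), ?_⟩
  obtain ⟨N, hN⟩ := eventually_atTop.1 (hw.eventually_ge_atTop ((x : ℝ) + 1))
  rw [Measure.sum_apply _ hopen.measurableSet, tsum_eq_sum (s := Finset.range N)]
  · refine ENNReal.sum_lt_top.2 fun k _ => ?_
    rw [Measure.smul_apply, smul_eq_mul]
    exact ENNReal.mul_lt_top (by simp) (measure_lt_top _ _)
  · intro k hk
    have hk' : N ≤ k := by simpa using hk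
    have h := hN k hk'
    rw [Measure.smul_apply, Measure.dirac_apply' _ hopen.measurableSet]
    simp [h]

/-- The rescaled point process `ν_n = ∑_{k ≥ 1} X_k δ_{z_k / z_n}` on `(0, ∞)`, for positive
`z_k → ∞`. The value of `X 0` plays no role. -/
noncomputable def rescaledProcess {Ω : Type*} (z : ℕ → ℝ) (hpos : ∀ k, 0 < z k)
    (hz : Tendsto z atTop atTop) (X : ℕ → Ω → ℕ) (n : ℕ) (ω : Ω) :
    LocFinMeasure (Ioi (0 : ℝ)) :=
  ⟨Measure.sum fun k : ℕ => (X (k + 1) ω : ℝ≥0∞) •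
      Measure.dirac (⟨z (k + 1) / z n, div_pos (hpos _) (hpos n)⟩ : Ioi (0 : ℝ)),
    isLocallyFiniteMeasure_sum_dirac
      (fun k => ⟨z (k + 1) / z n, div_pos (hpos _) (hpos n)⟩)
      (((tendsto_add_atTop_iff_nat 1).2 hz).atTop_div_const (hpos n))
      (fun k => X (k + 1) ω)⟩

/-- `D` is the generalized Dickman law with parameter `c`: a probability law on `[0, ∞)` which is
a fixed point of `W ↦ Q^{1/c} (W + 1)`, with `Q` uniform on `[0, 1]` and independent of `W`. -/
structure IsDickmanLaw (c : ℝ) (D : Measure ℝ) [IsProbabilityMeasure D] : Prop where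
  nonneg : D (Iio 0) = 0
  fixedPoint : (((volume : Measure ℝ).restrict (Icc 0 1)).prod D).map
    (fun p : ℝ × ℝ => p.1 ^ (1 / c) * (p.2 + 1)) = D

/-! ### The vague topology and convergence in distribution of random measures. -/

section VagueTopology

/-! Write `l k = c * log (z (k+1) / z k)`. For every `n` this is the mass that `c t⁻¹ dt` gives to
the cell `(z k / z n, z (k+1) / z n]`. The hypotheses say that `X (k+1)` has exactly the Poisson(`l
k`) mass `exp (-l k)` at `0`, and the Poisson mass at `1` up to `O(l k ^ 2)`. Hence its
characteristic function is within `8 * l k ^ 2` of the Poisson one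
(`norm_charFun_sub_poisson_le_sq`).

Point process: rounding the Poisson process up to the grid `z (k+1) / z n` gives independent
Poisson(`l k`) masses at the atoms of `ν_n`. By independence both characteristic functionals are
products, and they differ by at most the sum of the factorwise errors over the cells that meet the
support of the test function. The grid becomes fine on compact sets because consecutive ratios tend
to `1`, so the rounding disappears in the limit by dominated convergence. Countably many test
functions determine the vague topology, so characteristic functionals suffice.

Weighted sums: atoms near `0` now count, and there the quadratic error is not small in total. The
mean condition gives a second bound, linear in the weight (`norm_charFun_sub_poisson_le_mul`); the
geometric mean of the two bounds is of order `l k ^ (3/2) * √(z (k+1) / z n)`. These terms have a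
vanishing sum (`eventually_sum_logIncrement_mul_sqrt_le`), an estimate that also serves the first
half. The product of Poisson characteristic functions is the exponential of a Riemann sum for `dv /
v`, whose limit is the Dickman characteristic function, found by solving the differential equation
hidden in the fixed-point law. -/

theorem isInducing_pi_of_eq_iInf {M : Type*} [tM : TopologicalSpace M] {e : ℕ → M → ℝ}
    (he : tM = ⨅ i, TopologicalSpace.induced (e i) inferInstance) :
    IsInducing (fun x i => e i x) := by
  refine ⟨?_⟩
  rw [he]
  simp only [Pi.topologicalSpace, induced_iInf, induced_compose]
  rfl

/-- On a space whose topology is induced by countably many real functions, weak convergence of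
probability measures follows from convergence of the characteristic functions of the
finite-dimensional marginals. -/
theorem tendsto_probabilityMeasure_of_tendsto_charFun_marginals {M : Type*}
    [tM : TopologicalSpace M] [MeasurableSpace M] [BorelSpace M] {e : ℕ → M → ℝ}
    (he : tM = ⨅ i, TopologicalSpace.induced (e i) inferInstance)
    {μ : ℕ → ProbabilityMeasure M} {ν : ProbabilityMeasure M}
    (h : ∀ (m : ℕ) (t : Fin m → ℝ),
      Tendsto (fun n => ∫ x, Complex.exp ((∑ i, t i * e i x : ℝ) * Complex.I) ∂(μ n : Measure M))
        atTop (𝓝 (∫ x, Complex.exp ((∑ i, t i * e i x : ℝ) * Complex.I) ∂(ν : Measure M)))) :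
    Tendsto μ atTop (𝓝 ν) := by
  have hind := isInducing_pi_of_eq_iInf he
  have hcont : ∀ i, Continuous (e i) := fun i =>
    (continuous_apply i).comp hind.continuous
  let E : ∀ m : ℕ, M → EuclideanSpace ℝ (Fin m) := fun m x => WithLp.toLp 2 fun i => e i x
  have hE : ∀ m, Continuous (E m) := fun m =>
    (PiLp.continuous_toLp 2 _).comp (continuous_pi fun i => hcont i)
  have hchar : ∀ (ρ : ProbabilityMeasure M) (m : ℕ) (t : EuclideanSpace ℝ (Fin m)),
      charFun ((ρ.map (hE m).measurable.aemeasurable : ProbabilityMeasure _) : Measure _) t =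
        ∫ x, Complex.exp ((∑ i, t i * e i x : ℝ) * Complex.I) ∂(ρ : Measure M) := by
    intro ρ m t
    rw [charFun_apply, ProbabilityMeasure.toMeasure_map,
      integral_map (hE m).measurable.aemeasurable (by fun_prop)]
    rfl
  have hmarg : ∀ m, Tendsto (fun n => (μ n).map (hE m).measurable.aemeasurable) atTop
      (𝓝 (ν.map (hE m).measurable.aemeasurable)) := by
    intro m
    rw [ProbabilityMeasure.tendsto_iff_tendsto_charFun]
    intro t
    simp only [hchar]
    exact h m t
  -- Portmanteau: `G` is an increasing union of open cylinders, and each finite-dimensional marginal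
  -- controls its own cylinder.
  refine tendsto_of_forall_isOpen_le_liminf' fun G hG => ?_
  let V : ∀ m, Set (EuclideanSpace ℝ (Fin m)) := fun m => ⋃₀ {V | IsOpen V ∧ E m ⁻¹' V ⊆ G}
  have hVo : ∀ m, IsOpen (V m) := fun m => isOpen_sUnion fun _ hV => hV.1
  have hVG : ∀ m, E m ⁻¹' V m ⊆ G := by
    rintro m x ⟨W, hW, hx⟩
    exact hW.2 hx
  have hVmono : Monotone fun m => E m ⁻¹' V m := by
    rintro m m' hmm x ⟨W, hW, hx⟩
    refine ⟨(fun v => WithLp.toLp 2 fun i : Fin m => v (Fin.castLE hmm i)) ⁻¹' W,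
      ⟨hW.1.preimage ?_, hW.2⟩, hx⟩
    exact (PiLp.continuous_toLp 2 _).comp (by fun_prop)
  have hVun : ⋃ m, E m ⁻¹' V m = G := by
    refine subset_antisymm (iUnion_subset hVG) fun x hx => ?_
    obtain ⟨O, hO, rfl⟩ := hind.isOpen_iff.1 hG
    obtain ⟨I, u, hu, hIu⟩ := isOpen_pi_iff.1 hO _ hx
    -- A basic neighbourhood restricts only the coordinates in `I`, all of which are below `I.sup id
    -- + 1`.
    refine mem_iUnion.2 ⟨I.sup id + 1,
      {v | ∀ i : Fin (I.sup id + 1), (i : ℕ) ∈ I → v i ∈ u i}, ⟨?_, ?_⟩, ?_⟩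
    · have : {v : EuclideanSpace ℝ (Fin (I.sup id + 1)) |
            ∀ i : Fin (I.sup id + 1), (i : ℕ) ∈ I → v i ∈ u i} =
          ⋂ i : Fin (I.sup id + 1), ⋂ (_ : (i : ℕ) ∈ I), (fun v => v i) ⁻¹' u i := by
        ext v; simp
      rw [this]
      refine isOpen_iInter_of_finite fun i => isOpen_iInter_of_finite fun hi => ?_
      exact (hu i hi).1.preimage (by fun_prop)
    · intro y hy
      refine hIu fun i hi => ?_
      exact hy ⟨i, Nat.lt_succ_of_le (Finset.le_sup (f := id) hi)⟩ hi
    · exact fun i hi => (hu i hi).2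
  conv_lhs => rw [← hVun]
  rw [hVmono.measure_iUnion]
  refine iSup_le fun m => ?_
  have hl := ProbabilityMeasure.le_liminf_measure_open_of_tendsto (hmarg m) (hVo m)
  simp only [ProbabilityMeasure.toMeasure_map,
    Measure.map_apply (hE m).measurable (hVo m).measurableSet] at hl
  exact hl.trans (liminf_le_liminf (Eventually.of_forall fun n => measure_mono (hVG m)))

variable {S : Type*} [TopologicalSpace S] [MeasurableSpace S]

theorem LocFinMeasure.continuous_integral (f : C_c(S, ℝ≥0)) :
    Continuous fun μ : LocFinMeasure S => ∫ x, (f x : ℝ) ∂μ.1 :=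
  continuous_iff_le_induced.2 (iInf_le _ f)

theorem CompactlySupportedContinuousMap.integrable_coe_nnreal [OpensMeasurableSpace S]
    (μ : LocFinMeasure S) (f : C_c(S, ℝ≥0)) :
    Integrable (fun x => (f x : ℝ)) μ.1 := by
  have := μ.2
  refine Continuous.integrable_of_hasCompactSupport (by fun_prop) ?_
  exact f.hasCompactSupport.comp_left (g := ((↑) : ℝ≥0 → ℝ)) NNReal.coe_zero

variable [T2Space S] [LocallyCompactSpace S] [SecondCountableTopology S]
  [OpensMeasurableSpace S]

/-- The vague topology is induced by countably many test functions. -/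
theorem LocFinMeasure.exists_seq_vagueTopology_eq (S : Type*) [TopologicalSpace S]
    [MeasurableSpace S] [T2Space S] [LocallyCompactSpace S] [SecondCountableTopology S]
    [OpensMeasurableSpace S] :
    ∃ e : ℕ → C_c(S, ℝ≥0), LocFinMeasure.vagueTopology S =
      ⨅ i, TopologicalSpace.induced
        (fun μ : LocFinMeasure S => ∫ x, (e i x : ℝ) ∂μ.1) inferInstance := by
  have hcut : ∀ n, ∃ h : C_c(S, ℝ≥0), ∀ x ∈ CompactExhaustion.choice S n, h x = 1 := by
    intro n
    obtain ⟨f, hf1, -, hfc, -⟩ := exists_continuous_one_zero_of_isCompact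
      ((CompactExhaustion.choice S).isCompact n) isClosed_empty (disjoint_empty _)
    refine ⟨⟨(⟨Real.toNNReal, continuous_real_toNNReal⟩ : C(ℝ, ℝ≥0)).comp f,
      hfc.comp_left Real.toNNReal_zero⟩, fun x hx => ?_⟩
    change Real.toNNReal (f x) = 1
    rw [hf1 hx]; simp
  choose h hh using hcut
  obtain ⟨d, hd⟩ := TopologicalSpace.exists_dense_seq C(S, ℝ≥0)
  let g : ℕ × ℕ → C_c(S, ℝ≥0) := fun p =>
    ⟨(h p.1).toContinuousMap * d p.2, (h p.1).hasCompactSupport.mul_right⟩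
  have hg : ∀ p x, g p x = h p.1 x * d p.2 x := fun p x => rfl
  -- The countable family: cutoffs `h n`, and their products with a sequence dense for the
  -- compact-open topology. The cutoffs themselves are needed to bound masses locally.
  let T : TopologicalSpace (LocFinMeasure S) :=
    ⨅ i : ℕ × ℕ ⊕ ℕ, TopologicalSpace.induced
        (fun μ : LocFinMeasure S => ∫ x, (Sum.elim g h i x : ℝ) ∂μ.1) inferInstance
  have key : LocFinMeasure.vagueTopology S = T := by
    refine le_antisymm (le_iInf fun i => iInf_le _ (Sum.elim g h i)) (le_iInf fun f => ?_)
    rw [← continuous_iff_le_induced]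
    have hTh : ∀ n, Continuous[T, _] fun μ : LocFinMeasure S => ∫ x, (h n x : ℝ) ∂μ.1 :=
      fun n => continuous_iff_le_induced.2 (iInf_le _ (Sum.inr n))
    have hTg : ∀ p, Continuous[T, _] fun μ : LocFinMeasure S => ∫ x, (g p x : ℝ) ∂μ.1 :=
      fun p => continuous_iff_le_induced.2 (iInf_le _ (Sum.inl p))
    obtain ⟨n, hn⟩ := (CompactExhaustion.choice S).exists_superset_of_isCompact
      f.hasCompactSupport.isCompact
    have happrox : ∀ ε > 0, ∃ p, ∀ x, |(f x : ℝ) - g p x| ≤ ε * h n x := by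
      intro ε hε
      have hU : {k : C(S, ℝ≥0) | ∀ x ∈ tsupport (h n), dist (f x) (k x) < ε} ∈
          𝓝 f.toContinuousMap := by
        have := (ContinuousMap.tendsto_iff_forall_isCompact_tendstoUniformlyOn
          (f := f.toContinuousMap) (F := id) (p := 𝓝 f.toContinuousMap)).1 tendsto_id
          _ (h n).hasCompactSupport.isCompact
        exact Metric.tendstoUniformlyOn_iff.1 this ε hε
      obtain ⟨k, hk, j, rfl⟩ := mem_closure_iff_nhds.1 (hd f.toContinuousMap) _ hU
      refine ⟨(n, j), fun x => ?_⟩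
      rw [hg]
      by_cases hx : x ∈ tsupport (h n)
      · have hf : f x = h n x * f x := by
          by_cases hxf : x ∈ tsupport f
          · rw [hh n x (hn hxf), one_mul]
          · rw [image_eq_zero_of_notMem_tsupport hxf, mul_zero]
        rw [hf]
        push_cast
        rw [← mul_sub, abs_mul, NNReal.abs_eq, mul_comm]
        have := (hk x hx).le
        rw [NNReal.dist_eq] at this
        gcongr
      · have hx0 : h n x = 0 := image_eq_zero_of_notMem_tsupport hx
        have hfx : f x = 0 := by
          by_contra hne
          have := hh n x (hn (subset_tsupport _ hne))
          simp [hx0] at this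
        simp [hx0, hfx]
    -- Where `∫ h n dμ < B + 1`, the error `|f - g p| ≤ ε / (B + 2) * h n` integrates to less than
    -- `ε`, so `μ ↦ ∫ f dμ` is a locally uniform limit of `T`-continuous maps.
    refine @continuous_of_locally_uniform_approx_of_continuousAt _ _ T _ _ fun μ₀ u hu => ?_
    obtain ⟨ε, hε, hεu⟩ := Metric.mem_uniformity_dist.1 hu
    set B := ∫ x, (h n x : ℝ) ∂μ₀.1 with hB
    have hB0 : 0 ≤ B := integral_nonneg fun x => NNReal.coe_nonneg _
    obtain ⟨p, hp⟩ := happrox (ε / (B + 2)) (by positivity)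
    refine ⟨{μ | ∫ x, (h n x : ℝ) ∂μ.1 < B + 1}, ?_, _, (hTg p).continuousAt, fun μ hμ => hεu ?_⟩
    · exact (hTh n).continuousAt.eventually_lt_const (lt_add_one B)
    · have hi := CompactlySupportedContinuousMap.integrable_coe_nnreal μ
      rw [Real.dist_eq, ← integral_sub (hi f) (hi (g p))]
      calc |∫ x, ((f x : ℝ) - g p x) ∂μ.1| ≤ ∫ x, |(f x : ℝ) - g p x| ∂μ.1 :=
            abs_integral_le_integral_abs
        _ ≤ ∫ x, ε / (B + 2) * h n x ∂μ.1 :=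
            integral_mono ((hi f).sub (hi (g p))).abs ((hi (h n)).const_mul _) hp
        _ = ε / (B + 2) * ∫ x, (h n x : ℝ) ∂μ.1 := integral_const_mul _ _
        _ ≤ ε / (B + 2) * (B + 1) := by gcongr; exact hμ.le
        _ < ε := by
          rw [div_mul_eq_mul_div, div_lt_iff₀ (by positivity)]
          nlinarith
  obtain ⟨φ⟩ : Nonempty (ℕ ≃ ℕ × ℕ ⊕ ℕ) := inferInstance
  refine ⟨fun i => Sum.elim g h (φ i), key.trans ?_⟩
  exact (φ.iInf_comp (g := fun i => TopologicalSpace.induced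
        (fun μ : LocFinMeasure S => ∫ x, (Sum.elim g h i x : ℝ) ∂μ.1) inferInstance)).symm

theorem LocFinMeasure.measurable_of_measurable_integral {Ω : Type*} [MeasurableSpace Ω]
    {ξ : Ω → LocFinMeasure S}
    (h : ∀ f : C_c(S, ℝ≥0), Measurable fun ω => ∫ x, (f x : ℝ) ∂(ξ ω).1) : Measurable ξ := by
  obtain ⟨e, he⟩ := LocFinMeasure.exists_seq_vagueTopology_eq S
  have hind := isInducing_pi_of_eq_iInf he
  refine measurable_of_isOpen fun G hG => ?_
  obtain ⟨O, hO, rfl⟩ := hind.isOpen_iff.1 hG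
  exact (measurable_pi_iff.2 fun i => h (e i)) hO.measurableSet

theorem LocFinMeasure.measurable_of_measurable_apply {Ω : Type*} [MeasurableSpace Ω]
    {ξ : Ω → LocFinMeasure S}
    (h : ∀ B, MeasurableSet B → Measurable fun ω => (ξ ω).1 B) : Measurable ξ := by
  refine LocFinMeasure.measurable_of_measurable_integral fun f => ?_
  have hm : Measurable fun ω => (ξ ω).1 := Measure.measurable_of_measurable_coe _ h
  have hf : Measurable fun x => (f x : ℝ≥0∞) := by fun_prop
  have : (fun ω => ∫ x, (f x : ℝ) ∂(ξ ω).1) = fun ω => (∫⁻ x, (f x : ℝ≥0∞) ∂(ξ ω).1).toReal := by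
    ext ω
    rw [integral_eq_lintegral_of_nonneg_ae (ae_of_all _ fun x => NNReal.coe_nonneg _) (by fun_prop)]
    simp
  rw [this]
  exact ((Measure.measurable_lintegral hf).comp hm).ennreal_toReal

/-- Convergence in distribution of random measures follows from convergence of the characteristic
functions of the integrals of all compactly supported continuous functions. -/
theorem LocFinMeasure.tendstoInDistribution_of_tendsto_charFun {Ω Ω' : Type*}
    [MeasurableSpace Ω] [MeasurableSpace Ω'] {P : Measure Ω} [IsProbabilityMeasure P]
    {P' : Measure Ω'} [IsProbabilityMeasure P'] {ξ : ℕ → Ω → LocFinMeasure S}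
    {η : Ω' → LocFinMeasure S} (hξ : ∀ n, Measurable (ξ n)) (hη : Measurable η)
    (h : ∀ f : C_c(S, ℝ),
      Tendsto (fun n => ∫ ω, Complex.exp ((∫ x, f x ∂(ξ n ω).1 : ℝ) * Complex.I) ∂P) atTop
        (𝓝 (∫ ω, Complex.exp ((∫ x, f x ∂(η ω).1 : ℝ) * Complex.I) ∂P'))) :
    TendstoInDistribution ξ atTop η (fun _ => P) P' := by
  refine ⟨fun n => (hξ n).aemeasurable, hη.aemeasurable, ?_⟩
  obtain ⟨e, he⟩ := LocFinMeasure.exists_seq_vagueTopology_eq S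
  refine tendsto_probabilityMeasure_of_tendsto_charFun_marginals he fun m t => ?_
  -- Cramér–Wold: a real combination of test functions is one signed test function, which is why the
  -- hypothesis allows signs.
  let f : C_c(S, ℝ) := ∑ i : Fin m, t i • (e i).toReal
  have hf : ∀ μ : LocFinMeasure S, ∫ x, f x ∂μ.1 = ∑ i : Fin m, t i * ∫ x, (e i x : ℝ) ∂μ.1 := by
    intro μ
    have hfx : ∀ x, f x = ∑ i : Fin m, t i * (e i x : ℝ) := fun x => by simp [f]
    simp only [hfx]
    rw [integral_finsetSum _ fun (i : Fin m) _ =>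
      (CompactlySupportedContinuousMap.integrable_coe_nnreal μ (e i)).const_mul _]
    simp only [integral_const_mul]
  have hmeas : Measurable fun μ : LocFinMeasure S =>
      Complex.exp ((∑ i : Fin m, t i * ∫ x, (e i x : ℝ) ∂μ.1 : ℝ) * Complex.I) := by
    have := fun i => (LocFinMeasure.continuous_integral (e i)).measurable
    fun_prop
  simp only [ProbabilityMeasure.coe_mk]
  simp only [← hf] at hmeas ⊢
  rw [integral_map hη.aemeasurable hmeas.aestronglyMeasurable]
  refine (h f).congr fun n => ?_
  rw [integral_map (hξ n).aemeasurable hmeas.aestronglyMeasurable]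

end VagueTopology

/-! ### Characteristic functions close to Poisson ones. -/

section CharFunEstimates

/-- Exchange the factors one at a time; all the others lie in the unit disc. -/
theorem Finset.norm_prod_sub_prod_le {ι : Type*} (s : Finset ι) {a b : ι → ℂ}
    (ha : ∀ i ∈ s, ‖a i‖ ≤ 1) (hb : ∀ i ∈ s, ‖b i‖ ≤ 1) :
    ‖∏ i ∈ s, a i - ∏ i ∈ s, b i‖ ≤ ∑ i ∈ s, ‖a i - b i‖ := by
  classical
  induction s using Finset.induction_on with
  | empty => simp
  | insert j s hj ih =>
    rw [Finset.prod_insert hj, Finset.prod_insert hj, Finset.sum_insert hj]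
    have hP : ‖∏ i ∈ s, a i‖ ≤ 1 := by
      rw [norm_prod]
      exact Finset.prod_le_one (fun _ _ => norm_nonneg _)
        fun i hi => ha i (Finset.mem_insert_of_mem hi)
    have h1 := ih (fun i hi => ha i (Finset.mem_insert_of_mem hi))
      fun i hi => hb i (Finset.mem_insert_of_mem hi)
    have h2 := hb j (Finset.mem_insert_self _ _)
    calc ‖a j * ∏ i ∈ s, a i - b j * ∏ i ∈ s, b i‖
        = ‖(a j - b j) * ∏ i ∈ s, a i + b j * (∏ i ∈ s, a i - ∏ i ∈ s, b i)‖ := by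
          congr 1; ring
      _ ≤ ‖a j - b j‖ * ‖∏ i ∈ s, a i‖ + ‖b j‖ * ‖∏ i ∈ s, a i - ∏ i ∈ s, b i‖ := by
          refine (norm_add_le _ _).trans ?_
          rw [norm_mul, norm_mul]
      _ ≤ ‖a j - b j‖ * 1 + 1 * ∑ i ∈ s, ‖a i - b i‖ := by gcongr
      _ = _ := by ring

theorem norm_exp_mul_I_sub_one_le (x : ℝ) : ‖Complex.exp (x * Complex.I) - 1‖ ≤ |x| := by
  have := Real.norm_exp_I_mul_ofReal_sub_one_le (x := x)
  rwa [mul_comm, Real.norm_eq_abs] at this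

theorem norm_exp_mul_I_sub_one_le_two (x : ℝ) : ‖Complex.exp (x * Complex.I) - 1‖ ≤ 2 := by
  refine (norm_sub_le _ _).trans ?_
  rw [Complex.norm_exp_ofReal_mul_I]
  norm_num

theorem norm_poisson_charFun_le_one {l : ℝ} (hl : 0 ≤ l) (s : ℝ) :
    ‖Complex.exp (l * (Complex.exp (s * Complex.I) - 1))‖ ≤ 1 := by
  rw [Complex.norm_exp, Real.exp_le_one_iff, Complex.re_ofReal_mul]
  refine mul_nonpos_of_nonneg_of_nonpos hl ?_
  rw [Complex.sub_re, Complex.exp_ofReal_mul_I_re, Complex.one_re]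
  linarith [Real.cos_le_one s]

variable {Ω : Type*} [MeasurableSpace Ω] {P : Measure Ω}

theorem integral_exp_sum_mul_I_eq_prod {ι : Type*} {Y : ι → Ω → ℝ} (hY : ∀ k, AEMeasurable (Y k) P)
    (hind : iIndepFun Y P) (s : Finset ι) :
    ∫ ω, Complex.exp ((∑ k ∈ s, Y k ω : ℝ) * Complex.I) ∂P =
      ∏ k ∈ s, ∫ ω, Complex.exp ((Y k ω : ℝ) * Complex.I) ∂P := by
  have h := congrFun (iIndepFun.charFun_map_fun_finsetSum_eq_prod (s := s) (fun i _ => hY i)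
    (hind.restrict s)) 1
  have hsum : AEMeasurable (fun ω => ∑ k ∈ s, Y k ω) P :=
    Finset.aemeasurable_fun_sum _ fun i _ => hY i
  rw [charFun_apply_real, integral_map hsum (by fun_prop), Finset.prod_apply] at h
  simp only [Complex.ofReal_one, one_mul] at h
  rw [h]
  refine Finset.prod_congr rfl fun i _ => ?_
  rw [charFun_apply_real, integral_map (hY i) (by fun_prop)]
  simp

variable [IsProbabilityMeasure P]

theorem norm_integral_exp_mul_I_le_one (Y : Ω → ℝ) :
    ‖∫ ω, Complex.exp ((Y ω : ℝ) * Complex.I) ∂P‖ ≤ 1 := by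
  refine (norm_integral_le_integral_norm _).trans ?_
  simp [Complex.norm_exp_ofReal_mul_I]

/-- The characteristic function of a variable whose masses at `0` and `1` are `e⁻ˡ` and
`e⁻ˡ (1 - e⁻ˡ)` is close to that of a Poisson variable with mean `l`. -/
theorem norm_charFun_sub_poisson_le_sq {Y : Ω → ℕ} (hY : Measurable Y) {l : ℝ} (hl : 0 ≤ l)
    (h0 : P.real {ω | Y ω = 0} = Real.exp (-l))
    (h1 : P.real {ω | Y ω = 1} = Real.exp (-l) * (1 - Real.exp (-l))) (s : ℝ) :
    ‖∫ ω, Complex.exp ((s * Y ω : ℝ) * Complex.I) ∂P -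
      Complex.exp (l * (Complex.exp (s * Complex.I) - 1))‖ ≤ 8 * l ^ 2 := by
  rcases le_or_gt l (1 / 2) with hl2 | hl2
  swap
  -- For `l > 1 / 2` the trivial bound `2` is already below `8 * l ^ 2`.
  · refine (norm_sub_le _ _).trans ?_
    have := norm_integral_exp_mul_I_le_one (P := P) fun ω => s * Y ω
    have := norm_poisson_charFun_le_one hl s
    nlinarith
  set e : ℂ := Complex.exp (s * Complex.I) with he
  have hen : ‖e‖ = 1 := Complex.norm_exp_ofReal_mul_I s
  set q := Real.exp (-l) with hq
  have hq1 : q ≤ 1 := by rw [hq, Real.exp_le_one_iff]; linarith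
  have hql : 1 - l ≤ q := by have := Real.add_one_le_exp (-l); linarith
  have hqu : |q - 1 + l| ≤ l ^ 2 := by
    have hln : ‖-l‖ ≤ 1 := by
      rw [norm_neg, Real.norm_eq_abs, abs_of_nonneg hl]
      linarith
    have := Real.norm_exp_sub_one_sub_id_le hln
    simpa using this
  have hm0 : MeasurableSet {ω | Y ω = 0} := hY (measurableSet_singleton 0)
  have hm1 : MeasurableSet {ω | Y ω = 1} := hY (measurableSet_singleton 1)
  set A : Ω → ℂ := {ω | Y ω = 0}.indicator fun _ => 1
  set B : Ω → ℂ := {ω | Y ω = 1}.indicator fun _ => e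
  have hA : Integrable A P := (integrable_const _).indicator hm0
  have hB : Integrable B P := (integrable_const _).indicator hm1
  have hAi : ∫ ω, A ω ∂P = q := by
    rw [integral_indicator_const _ hm0, h0]; simp
  have hBi : ∫ ω, B ω ∂P = (q * (1 - q) : ℝ) * e := by
    rw [integral_indicator_const _ hm1, h1]; simp
  have hExp : Integrable (fun ω => Complex.exp ((s * Y ω : ℝ) * Complex.I)) P := by
    refine Integrable.of_bound (C := 1) ?_ (ae_of_all _ fun ω => ?_)
    · exact Measurable.aestronglyMeasurable (by fun_prop)
    · rw [Complex.norm_exp_ofReal_mul_I]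
  -- What remains lives on `{Y ≥ 2}`, of probability `1 - q - q (1 - q) = (1 - q) ^ 2`.
  have hR : ‖∫ ω, (Complex.exp ((s * Y ω : ℝ) * Complex.I) - A ω - B ω) ∂P‖ ≤ (1 - q) ^ 2 := by
    have hA' : Integrable ({ω | Y ω = 0}.indicator fun _ => (1 : ℝ)) P :=
      (integrable_const _).indicator hm0
    have hB' : Integrable ({ω | Y ω = 1}.indicator fun _ => (1 : ℝ)) P :=
      (integrable_const _).indicator hm1
    have hint : ∫ ω, ((1 : ℝ) - {ω | Y ω = 0}.indicator (fun _ => (1 : ℝ)) ω -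
        {ω | Y ω = 1}.indicator (fun _ => (1 : ℝ)) ω) ∂P = (1 - q) ^ 2 := by
      have h1A : Integrable (fun ω => (1 : ℝ) - {ω | Y ω = 0}.indicator (fun _ => (1 : ℝ)) ω) P :=
        (integrable_const _).sub hA'
      rw [integral_sub h1A hB', integral_sub (integrable_const _) hA',
        integral_indicator_const _ hm0, integral_indicator_const _ hm1, h0, h1]
      simp
      ring
    rw [← hint]
    refine norm_integral_le_of_norm_le (((integrable_const _).sub hA').sub hB')
      (ae_of_all _ fun ω => ?_)
    by_cases hω0 : Y ω = 0
    · simp [A, B, hω0]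
    by_cases hω1 : Y ω = 1
    · simp [A, B, hω1, he]
    · have : ‖Complex.exp ((s * Y ω : ℝ) * Complex.I)‖ = 1 := Complex.norm_exp_ofReal_mul_I _
      simp only [A, B, indicator_apply, mem_ofPred_eq, hω0, hω1, if_false, sub_zero, this, le_refl]
  have hsub : ∫ ω, (Complex.exp ((s * Y ω : ℝ) * Complex.I) - A ω - B ω) ∂P =
      ∫ ω, Complex.exp ((s * Y ω : ℝ) * Complex.I) ∂P - q - (q * (1 - q) : ℝ) * e := by
    have hExpA : Integrable (fun ω => Complex.exp ((s * Y ω : ℝ) * Complex.I) - A ω) P :=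
      hExp.sub hA
    rw [integral_sub hExpA hB, integral_sub hExp hA, hAi, hBi]
  rw [hsub] at hR
  set a := ∫ ω, Complex.exp ((s * Y ω : ℝ) * Complex.I) ∂P
  have hv : ‖(l : ℂ) * (e - 1)‖ ≤ 2 * l := by
    rw [norm_mul, Complex.norm_real, Real.norm_eq_abs, abs_of_nonneg hl, mul_comm]
    gcongr
    exact norm_exp_mul_I_sub_one_le_two s
  have hb := Complex.norm_exp_sub_one_sub_id_le (x := l * (e - 1)) (by linarith)
  have hb' : ‖Complex.exp (l * (e - 1)) - 1 - l * (e - 1)‖ ≤ 4 * l ^ 2 := by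
    refine hb.trans ?_
    calc ‖(l : ℂ) * (e - 1)‖ ^ 2 ≤ (2 * l) ^ 2 := by gcongr
      _ = 4 * l ^ 2 := by ring
  have hc1 : ‖((q - 1 + l : ℝ) : ℂ)‖ ≤ l ^ 2 := by
    rwa [Complex.norm_real, Real.norm_eq_abs]
  have hp2 : (1 - q) ^ 2 ≤ l ^ 2 := by
    have : 0 ≤ 1 - q := by linarith
    gcongr; linarith
  have hc2 : ‖((q * (1 - q) - l : ℝ) : ℂ) * e‖ ≤ 2 * l ^ 2 := by
    rw [norm_mul, hen, mul_one, Complex.norm_real, Real.norm_eq_abs]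
    have : q * (1 - q) - l = -(q - 1 + l) - (1 - q) ^ 2 := by ring
    rw [this]
    refine (abs_sub _ _).trans ?_
    rw [abs_neg, abs_of_nonneg (sq_nonneg (1 - q))]
    linarith
  -- Four errors, contributing `1 + 1 + 2 + 4 = 8`: the part `Y ≥ 2`, the mass at `0` against `1 -
  -- l`, the mass at `1` against `l`, and the linearised exponential.
  calc ‖a - Complex.exp (l * (e - 1))‖
      = ‖(a - q - (q * (1 - q) : ℝ) * e) + ((q - 1 + l : ℝ) : ℂ) + ((q * (1 - q) - l : ℝ) : ℂ) * e
          - (Complex.exp (l * (e - 1)) - 1 - l * (e - 1))‖ := by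
        congr 1; push_cast; ring
    _ ≤ (1 - q) ^ 2 + l ^ 2 + 2 * l ^ 2 + 4 * l ^ 2 := by
        refine (norm_sub_le _ _).trans (add_le_add ?_ hb')
        refine (norm_add_le _ _).trans (add_le_add ?_ hc2)
        exact (norm_add_le _ _).trans (add_le_add hR hc1)
    _ ≤ 8 * l ^ 2 := by linarith

/-- Both characteristic functions are compared with `1`. Unlike the quadratic bound, this one
vanishes as `s → 0`, as small weights require. -/
theorem norm_charFun_sub_poisson_le_mul {Y : Ω → ℕ} (hY : Measurable Y) {l : ℝ} (hl : 0 ≤ l)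
    (hl2 : l ≤ 1 / 2) {C : ℝ} (hC : 0 ≤ C)
    (hEY : ∫⁻ ω, (Y ω : ℝ≥0∞) ∂P ≤ ENNReal.ofReal (C * l)) (s : ℝ) :
    ‖∫ ω, Complex.exp ((s * Y ω : ℝ) * Complex.I) ∂P -
      Complex.exp (l * (Complex.exp (s * Complex.I) - 1))‖ ≤ (C + 2) * l * |s| := by
  have hYi : Integrable (fun ω => (Y ω : ℝ)) P := by
    refine ⟨Measurable.aestronglyMeasurable (by fun_prop), ?_⟩
    refine lt_of_le_of_lt ?_ ((hEY).trans_lt ENNReal.ofReal_lt_top)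
    exact lintegral_mono fun ω => by simp
  have hEY' : ∫ ω, (Y ω : ℝ) ∂P ≤ C * l := by
    rw [integral_eq_lintegral_of_nonneg_ae (ae_of_all _ fun _ => Nat.cast_nonneg _)
      (Measurable.aestronglyMeasurable (by fun_prop))]
    refine ENNReal.toReal_le_of_le_ofReal (by positivity) ?_
    simpa using hEY
  have hExp : Integrable (fun ω => Complex.exp ((s * Y ω : ℝ) * Complex.I)) P := by
    refine Integrable.of_bound (C := 1) ?_ (ae_of_all _ fun ω => ?_)
    · exact Measurable.aestronglyMeasurable (by fun_prop)
    · rw [Complex.norm_exp_ofReal_mul_I]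
  have ha : ‖∫ ω, Complex.exp ((s * Y ω : ℝ) * Complex.I) ∂P - 1‖ ≤ C * l * |s| := by
    have : ∫ ω, Complex.exp ((s * Y ω : ℝ) * Complex.I) ∂P - 1 =
        ∫ ω, (Complex.exp ((s * Y ω : ℝ) * Complex.I) - 1) ∂P := by
      rw [integral_sub hExp (integrable_const _)]; simp
    rw [this]
    refine (norm_integral_le_of_norm_le (hYi.const_mul |s|) (ae_of_all _ fun ω => ?_)).trans ?_
    · refine (norm_exp_mul_I_sub_one_le _).trans_eq ?_
      rw [abs_mul, Nat.abs_cast]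
    · rw [integral_const_mul, mul_comm]
      gcongr
  have hb : ‖Complex.exp (l * (Complex.exp (s * Complex.I) - 1)) - 1‖ ≤ 2 * l * |s| := by
    have hv : ‖(l : ℂ) * (Complex.exp (s * Complex.I) - 1)‖ =
        l * ‖Complex.exp (s * Complex.I) - 1‖ := by
      rw [norm_mul, Complex.norm_real, Real.norm_eq_abs, abs_of_nonneg hl]
    have h2 := norm_exp_mul_I_sub_one_le_two s
    refine (Complex.norm_exp_sub_one_le (by rw [hv]; nlinarith)).trans ?_
    rw [hv, mul_assoc]
    gcongr
    exact norm_exp_mul_I_sub_one_le s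
  rw [← sub_sub_sub_cancel_right _ _ (1 : ℂ)]
  refine (norm_sub_le _ _).trans ((add_le_add ha hb).trans_eq ?_)
  ring

end CharFunEstimates

/-! ### Summing the errors over the grid. -/

section LogIncrements

/-- The mass `c log (z_{k+1} / z_k)` given by `c t⁻¹ dt` to `(z_k / a, z_{k+1} / a]`. -/
noncomputable def logIncrement (c : ℝ) (z : ℕ → ℝ) (k : ℕ) : ℝ := c * Real.log (z (k + 1) / z k)

variable {c : ℝ} {z : ℕ → ℝ}

theorem logIncrement_nonneg (hc : 0 ≤ c) (hpos : ∀ k, 0 < z k) (hmono : Monotone z) (k : ℕ) :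
    0 ≤ logIncrement c z k :=
  mul_nonneg hc (Real.log_nonneg ((one_le_div (hpos k)).2 (hmono k.le_succ)))

theorem exp_neg_logIncrement (hpos : ∀ k, 0 < z k) (k : ℕ) :
    Real.exp (-logIncrement c z k) = (z k / z (k + 1)) ^ c := by
  rw [Real.rpow_def_of_pos (div_pos (hpos _) (hpos _)), logIncrement, ← inv_div (z k), Real.log_inv]
  congr 1; ring

theorem tendsto_logIncrement (hratio : Tendsto (fun k => z (k + 1) / z k) atTop (𝓝 1)) :
    Tendsto (logIncrement c z) atTop (𝓝 0) := by
  have := ((Real.continuousAt_log one_ne_zero).tendsto.comp hratio).const_mul c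
  rw [Real.log_one, mul_zero] at this
  exact this

/-- From `log t ≤ t - 1`, `l k * √(z (k+1))` is at most a bounded multiple of `√(z (k+1)) - √(z k)`.
The further factor `√(l k)` tends to `0`, and the differences telescope to a divergent sum, so the
little-o passes to partial sums. -/
theorem sum_logIncrement_mul_sqrt_isLittleO (hc : 0 < c) (hpos : ∀ k, 0 < z k)
    (hmono : Monotone z) (hz : Tendsto z atTop atTop)
    (hratio : Tendsto (fun k => z (k + 1) / z k) atTop (𝓝 1)) :
    (fun m => ∑ k ∈ Finset.range m,
      logIncrement c z k * √(logIncrement c z k) * √(z (k + 1))) =o[atTop] fun m => √(z m) := by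
  set g : ℕ → ℝ := fun k => √(z (k + 1)) - √(z k)
  have hg : 0 ≤ g := fun k => sub_nonneg.2 (Real.sqrt_le_sqrt (hmono k.le_succ))
  have hsum : ∀ n, ∑ k ∈ Finset.range n, g k = √(z n) - √(z 0) := fun n =>
    Finset.sum_range_sub (fun k => √(z k)) n
  have hsq : Tendsto (fun n => √(z n)) atTop atTop := Real.tendsto_sqrt_atTop.comp hz
  have hgt : Tendsto (fun n => ∑ k ∈ Finset.range n, g k) atTop atTop := by
    simp only [hsum]
    exact tendsto_atTop_add_const_right _ _ hsq
  have hfg : (fun k => logIncrement c z k * √(logIncrement c z k) * √(z (k + 1))) =o[atTop] g := by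
    have hl : Tendsto (fun k => √(logIncrement c z k) * (2 * c * (z (k + 1) / z k))) atTop
        (𝓝 0) := by
      have := ((Real.continuous_sqrt.tendsto 0).comp (tendsto_logIncrement (c := c) hratio)).mul
        (hratio.const_mul (2 * c))
      simpa using this
    refine Asymptotics.isLittleO_of_tendsto' (Eventually.of_forall fun k hk => ?_) ?_
    · have h1 : z (k + 1) = z k := by
        have : √(z (k + 1)) = √(z k) := sub_eq_zero.1 hk
        exact (Real.sqrt_inj (hpos _).le (hpos _).le).1 this
      simp [logIncrement, h1, (hpos k).ne']
    · refine squeeze_zero (fun k => ?_) (fun k => ?_) hl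
      · have := logIncrement_nonneg hc.le hpos hmono k
        have : (0 : ℝ) ≤ g k := hg k
        positivity
      · have h0 := logIncrement_nonneg hc.le hpos hmono k
        refine div_le_of_le_mul₀ (hg k) ?_ ?_
        · have := hpos k; have := hpos (k + 1); positivity
        · have hzk := hpos k
          have hmk := hmono k.le_succ
          set x := √(z k)
          set y := √(z (k + 1))
          have hx : x ^ 2 = z k := Real.sq_sqrt hzk.le
          have hy : y ^ 2 = z (k + 1) := Real.sq_sqrt (hpos _).le
          have hx0 : 0 < x := Real.sqrt_pos.2 hzk
          have hxy : x ≤ y := Real.sqrt_le_sqrt hmk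
          have hlog : logIncrement c z k ≤ c * ((y ^ 2 - x ^ 2) / x ^ 2) := by
            unfold logIncrement
            gcongr
            refine (Real.log_le_sub_one_of_pos (div_pos (hpos _) hzk)).trans_eq ?_
            rw [← hx, ← hy]
            field_simp
          have hly : logIncrement c z k * y ≤ 2 * c * (y ^ 2 / x ^ 2) * (y - x) := by
            calc logIncrement c z k * y ≤ c * ((y ^ 2 - x ^ 2) / x ^ 2) * y := by gcongr
              _ = c * (y - x) * ((y + x) * y) / x ^ 2 := by ring
              _ ≤ c * (y - x) * ((y + y) * y) / x ^ 2 := by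
                have := sub_nonneg.2 hxy
                gcongr
              _ = _ := by ring
          have := mul_le_mul_of_nonneg_left hly (Real.sqrt_nonneg (logIncrement c z k))
          rw [← hx, ← hy]
          calc logIncrement c z k * √(logIncrement c z k) * y
              = √(logIncrement c z k) * (logIncrement c z k * y) := by ring
            _ ≤ _ := this
            _ = _ := by simp only [g, x, y]; ring
  have := hfg.sum_range hg hgt
  refine this.trans_isBigO (Asymptotics.IsBigO.of_bound 1 (Eventually.of_forall fun n => ?_))
  rw [hsum, Real.norm_eq_abs, Real.norm_eq_abs, abs_of_nonneg (Real.sqrt_nonneg _), one_mul,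
    abs_of_nonneg (sub_nonneg.2 (Real.sqrt_le_sqrt (hmono n.zero_le)))]
  linarith [Real.sqrt_nonneg (z 0)]

theorem eventually_sum_logIncrement_mul_sqrt_le (hc : 0 < c) (hpos : ∀ k, 0 < z k)
    (hmono : Monotone z) (hz : Tendsto z atTop atTop)
    (hratio : Tendsto (fun k => z (k + 1) / z k) atTop (𝓝 1)) (b : ℝ) {ε : ℝ} (hε : 0 < ε) :
    ∀ᶠ n in atTop, ∀ m, (∀ k < m, z (k + 1) / z n ≤ b) →
      ∑ k ∈ Finset.range m,
        logIncrement c z k * √(logIncrement c z k) * √(z (k + 1) / z n) ≤ ε := by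
  set F : ℕ → ℝ := fun m => ∑ k ∈ Finset.range m,
      logIncrement c z k * √(logIncrement c z k) * √(z (k + 1))
  have hF := sum_logIncrement_mul_sqrt_isLittleO hc hpos hmono hz hratio
  have hFmono : Monotone F := monotone_nat_of_le_succ fun m => by
    simp only [F, Finset.sum_range_succ]
    have := logIncrement_nonneg hc.le hpos hmono m
    have : 0 ≤ logIncrement c z m * √(logIncrement c z m) * √(z (m + 1)) := by positivity
    linarith
  -- Blocks shorter than `m₀` are absorbed by `z n → ∞`, longer ones by the little-o bound. The `+
  -- 1` keeps the denominator positive when `√b = 0`.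
  obtain ⟨m₀, hm₀⟩ := eventually_atTop.1 (hF.def (c := ε / (√b + 1)) (by positivity))
  have hsq : Tendsto (fun n => ε * √(z n)) atTop atTop :=
    (Real.tendsto_sqrt_atTop.comp hz).const_mul_atTop hε
  filter_upwards [hsq.eventually_ge_atTop (F m₀)] with n hn m hm
  have hzn := hpos n
  have hsum : ∑ k ∈ Finset.range m,
        logIncrement c z k * √(logIncrement c z k) * √(z (k + 1) / z n) = F m / √(z n) := by
    rw [Finset.sum_div]
    refine Finset.sum_congr rfl fun k _ => ?_
    rw [Real.sqrt_div (hpos _).le, mul_div_assoc]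
  rw [hsum, div_le_iff₀ (Real.sqrt_pos.2 hzn)]
  rcases le_total m m₀ with h | h
  · exact (hFmono h).trans hn
  · rcases m with _ | m
    · simp only [F, Finset.range_zero, Finset.sum_empty]; positivity
    have h1 := (Real.norm_eq_abs _ ▸ le_abs_self _).trans (hm₀ _ h)
    rw [Real.norm_eq_abs, abs_of_nonneg (Real.sqrt_nonneg _)] at h1
    have h2 : √(z (m + 1)) ≤ √b * √(z n) := by
      rw [← Real.sqrt_mul' _ hzn.le]
      exact Real.sqrt_le_sqrt ((div_le_iff₀ hzn).1 (hm m m.lt_succ_self))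
    refine h1.trans ?_
    calc ε / (√b + 1) * √(z (m + 1)) ≤ ε / (√b + 1) * ((√b + 1) * √(z n)) := by
          gcongr
          nlinarith [Real.sqrt_nonneg (z n)]
      _ = ε * √(z n) := by field_simp

end LogIncrements

/-! ### Rounding up to the grid. -/

section Grid

/-- The least `k` with `a ≤ z (k + 1)`. -/
noncomputable def gridIndex (z : ℕ → ℝ) (a : ℝ) : ℕ := sInf {k | a ≤ z (k + 1)}

/-- Rounding up of `t` to the grid `z 1 / z n, z 2 / z n, …`. -/
noncomputable def gridCeil (z : ℕ → ℝ) (n : ℕ) (t : ℝ) : ℝ := z (gridIndex z (t * z n) + 1) / z n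

variable {z : ℕ → ℝ}

theorem le_gridIndex (hz : Tendsto z atTop atTop) (a : ℝ) : a ≤ z (gridIndex z a + 1) :=
  Nat.sInf_mem (s := {k | a ≤ z (k + 1)})
    (((tendsto_add_atTop_iff_nat 1).2 hz).eventually_ge_atTop a).exists

theorem lt_of_lt_gridIndex {a : ℝ} (ha : z 0 < a) : z (gridIndex z a) < a := by
  rcases h : gridIndex z a with _ | j
  · exact ha
  · have : j ∉ {k | a ≤ z (k + 1)} := Nat.notMem_of_lt_sInf (by
      change j < gridIndex z a
      omega)
    exact not_le.1 this

theorem gridIndex_mono (hz : Tendsto z atTop atTop) : Monotone (gridIndex z) := fun _ b hab =>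
  Nat.sInf_le (hab.trans (le_gridIndex hz b))

theorem gridIndex_eq (hz : Tendsto z atTop atTop) (hmono : Monotone z) {a : ℝ} {k : ℕ}
    (h1 : z k < a) (h2 : a ≤ z (k + 1)) : gridIndex z a = k := by
  refine le_antisymm (Nat.sInf_le h2) (not_lt.1 fun h => ?_)
  exact absurd ((le_gridIndex hz a).trans (hmono h)) (not_le.2 h1)

theorem gridCeil_pos (hpos : ∀ k, 0 < z k) (n : ℕ) (t : ℝ) : 0 < gridCeil z n t := div_pos (hpos _) (hpos _)

theorem le_gridCeil (hpos : ∀ k, 0 < z k) (hz : Tendsto z atTop atTop) (n : ℕ) (t : ℝ) : t ≤ gridCeil z n t :=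
  (le_div_iff₀ (hpos n)).2 (le_gridIndex hz _)

theorem measurable_gridCeil (hz : Tendsto z atTop atTop) (n : ℕ) : Measurable (gridCeil z n) := by
  have h1 : Measurable (gridIndex z) := (gridIndex_mono hz).measurable
  have h2 : Measurable z := measurable_of_countable z
  exact (h2.comp ((h1.comp (measurable_id.mul_const (z n))).add_const 1)).div_const _

theorem gridCeil_eq (hpos : ∀ k, 0 < z k) (hmono : Monotone z) (hz : Tendsto z atTop atTop) {n k : ℕ} {t : ℝ} (h1 : z k / z n < t) (h2 : t ≤ z (k + 1) / z n) :
    gridCeil z n t = z (k + 1) / z n := by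
  rw [gridCeil, gridIndex_eq hz hmono ((div_lt_iff₀ (hpos n)).1 h1) ((le_div_iff₀ (hpos n)).1 h2)]

/-- Rounding costs at most one consecutive ratio. This gives both the convergence to `t` and, as the
ratios are bounded, the domination used later. -/
theorem gridCeil_le_ratio_mul (hpos : ∀ k, 0 < z k) {n : ℕ} {t : ℝ} (ht : z 0 < t * z n) :
    gridCeil z n t ≤ z (gridIndex z (t * z n) + 1) / z (gridIndex z (t * z n)) * t := by
  have h := (lt_of_lt_gridIndex ht).le
  have hj := hpos (gridIndex z (t * z n))
  have hj' := hpos (gridIndex z (t * z n) + 1)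
  have hn := hpos n
  rw [gridCeil, div_mul_eq_mul_div, div_le_div_iff₀ hn hj, mul_assoc]
  gcongr

theorem tendsto_gridCeil (hpos : ∀ k, 0 < z k) (hmono : Monotone z) (hz : Tendsto z atTop atTop) (hratio : Tendsto (fun k => z (k + 1) / z k) atTop (𝓝 1)) {t : ℝ}
    (ht : 0 < t) : Tendsto (fun n => gridCeil z n t) atTop (𝓝 t) := by
  have hidx : Tendsto (fun n => gridIndex z (t * z n)) atTop atTop := by
    refine tendsto_atTop_atTop.2 fun N => ?_
    obtain ⟨n₀, hn₀⟩ := eventually_atTop.1 ((hz.const_mul_atTop ht).eventually_gt_atTop (z N))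
    refine ⟨n₀, fun n hn => not_lt.1 fun h => ?_⟩
    exact absurd ((le_gridIndex hz _).trans (hmono h)) (not_le.2 (hn₀ n hn))
  have hup := (hratio.comp hidx).mul_const t
  rw [one_mul] at hup
  refine tendsto_of_tendsto_of_tendsto_of_le_of_le' tendsto_const_nhds hup
    (Eventually.of_forall fun n => le_gridCeil hpos hz n t) ?_
  filter_upwards [(hz.const_mul_atTop ht).eventually_gt_atTop (z 0)] with n hn
  exact gridCeil_le_ratio_mul hpos hn

theorem exists_ratio_le (hratio : Tendsto (fun k => z (k + 1) / z k) atTop (𝓝 1)) :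
    ∃ R, 1 ≤ R ∧ ∀ k, z (k + 1) / z k ≤ R := by
  obtain ⟨R, hR⟩ := hratio.bddAbove_range
  exact ⟨max R 1, le_max_right _ _, fun k => (hR ⟨k, rfl⟩).trans (le_max_left _ _)⟩

theorem exists_forall_grid_le_iff (hpos : ∀ k, 0 < z k) (hmono : Monotone z) (hz : Tendsto z atTop atTop) (n : ℕ) (b : ℝ) :
    ∃ m, ∀ k, z (k + 1) / z n ≤ b ↔ k < m := by
  classical
  have h : ∃ k, b < z (k + 1) / z n :=
    ((((tendsto_add_atTop_iff_nat 1).2 hz).atTop_div_const (hpos n)).eventually_gt_atTop b).exists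
  refine ⟨Nat.find h, fun k => ⟨fun hk => not_le.1 fun hle => ?_, fun hk => ?_⟩⟩
  · have := Nat.find_spec h
    have h2 : z (Nat.find h + 1) / z n ≤ z (k + 1) / z n := by
      have := hpos n
      have := hmono (Nat.succ_le_succ hle)
      gcongr
    linarith
  · exact not_lt.1 (Nat.find_min h hk)

end Grid

/-! ### Intensity and Poisson counts of the cells. -/

section PoissonCells

theorem scaleInvariantIntensity_Ioc {c a b : ℝ} (hc : 0 ≤ c) (ha : 0 < a) (hab : a ≤ b) :
    scaleInvariantIntensity c (Subtype.val ⁻¹' Ioc a b) = ENNReal.ofReal (c * Real.log (b / a)) := by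
  have hm : MeasurableSet (Ioc a b) := measurableSet_Ioc
  have hsub : Ioc a b ⊆ Ioi 0 := fun x hx => ha.trans hx.1
  have hcont : ContinuousOn (fun t : ℝ => c / t) (Icc a b) :=
    continuousOn_const.div continuousOn_id fun x hx => (ha.trans_le hx.1).ne'
  rw [scaleInvariantIntensity, withDensity_apply _ (measurable_subtype_coe hm),
    ← setLIntegral_map (f := fun t : ℝ => ENNReal.ofReal (c / t)) hm (by fun_prop)
      measurable_subtype_coe,
    (MeasurableEmbedding.subtype_coe measurableSet_Ioi).map_comap, Subtype.range_coe,
    Measure.restrict_restrict hm, inter_eq_self_of_subset_left hsub,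
    ← ofReal_integral_eq_lintegral_ofReal, ← intervalIntegral.integral_of_le hab]
  · congr 1
    simp only [div_eq_mul_one_div c]
    rw [intervalIntegral.integral_const_mul, integral_one_div_of_pos ha (ha.trans_le hab)]
  · exact (hcont.integrableOn_Icc).mono_set Ioc_subset_Icc_self
  · refine (ae_restrict_iff' hm).2 (ae_of_all _ fun t ht => ?_)
    exact div_nonneg hc (hsub ht).le

theorem integral_exp_mul_I_of_map_eq_poisson {Ω : Type*} [MeasurableSpace Ω] {P : Measure Ω}
    {N : Ω → ℝ≥0∞} (hN : Measurable N) {r : ℝ≥0}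
    (h : P.map N = (poissonMeasure r).map (fun m : ℕ => (m : ℝ≥0∞))) (s : ℝ) :
    ∫ ω, Complex.exp ((s * (N ω).toReal : ℝ) * Complex.I) ∂P =
      Complex.exp (r * (Complex.exp (s * Complex.I) - 1)) := by
  have hm : Measurable fun x : ℝ≥0∞ => Complex.exp ((s * x.toReal : ℝ) * Complex.I) := by fun_prop
  rw [← integral_map (f := fun x : ℝ≥0∞ => Complex.exp ((s * x.toReal : ℝ) * Complex.I))
    hN.aemeasurable hm.aestronglyMeasurable, h, integral_map .of_discrete hm.aestronglyMeasurable,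
    ← charFun_map_cast_poissonMeasure, charFun_apply_real, integral_map .of_discrete (by fun_prop)]
  simp

theorem measure_preimage_Icc_lt_top (μ : LocFinMeasure (Ioi (0 : ℝ))) {a b : ℝ} (ha : 0 < a) :
    μ.1 (Subtype.val ⁻¹' Icc a b) < ∞ := by
  have := μ.2
  have hK : IsCompact ((Subtype.val : Ioi (0 : ℝ) → ℝ) ⁻¹' Icc a b) := by
    rw [Subtype.isCompact_iff, image_preimage_eq_of_subset]
    · exact isCompact_Icc
    · rw [Subtype.range_coe]
      exact fun x hx => ha.trans_le hx.1
  exact hK.measure_lt_top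

end PoissonCells

/-! ### Convergence of the point processes. -/

section PointProcess

theorem CompactlySupportedContinuousMap.exists_support_subset_Icc (f : C_c(Ioi (0 : ℝ), ℝ)) :
    ∃ a b : ℝ, 0 < a ∧ ∀ x : Ioi (0 : ℝ), f x ≠ 0 → a ≤ x ∧ (x : ℝ) ≤ b := by
  have hK : IsCompact (Subtype.val '' tsupport f) :=
    f.hasCompactSupport.isCompact.image continuous_subtype_val
  rcases (Subtype.val '' tsupport f).eq_empty_or_nonempty with h | h
  · refine ⟨1, 1, one_pos, fun x hx => ?_⟩
    have : (x : ℝ) ∈ Subtype.val '' tsupport f := ⟨x, subset_tsupport _ hx, rfl⟩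
    simp [h] at this
  · obtain ⟨a, ⟨⟨a', -, rfl⟩, ha⟩⟩ := hK.exists_isLeast h
    obtain ⟨b, hb⟩ := hK.bddAbove
    refine ⟨a', b, a'.2, fun x hx => ?_⟩
    have : (x : ℝ) ∈ Subtype.val '' tsupport f := ⟨x, subset_tsupport _ hx, rfl⟩
    exact ⟨ha this, hb this⟩

variable {z : ℕ → ℝ}

theorem gridCeil_eq_of_le (hmono : Monotone z) {n : ℕ} {t : ℝ}
    (h : t * z n ≤ z 0) : gridCeil z n t = z 1 / z n := by
  have : gridIndex z (t * z n) = 0 :=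
    Nat.le_zero.1 (Nat.sInf_le (s := {k | t * z n ≤ z (k + 1)}) (h.trans (hmono zero_le_one)))
  rw [gridCeil, this]

/-- The point `z (k + 1) / z n` of `(0, ∞)`. -/
noncomputable def gridPoint (z : ℕ → ℝ) (hpos : ∀ k, 0 < z k) (n k : ℕ) : Ioi (0 : ℝ) :=
  ⟨z (k + 1) / z n, div_pos (hpos _) (hpos n)⟩

/-- The grid cell `(z k / z n, z (k + 1) / z n]`. -/
def gridCell (z : ℕ → ℝ) (n k : ℕ) : Set (Ioi (0 : ℝ)) :=
  Subtype.val ⁻¹' Ioc (z k / z n) (z (k + 1) / z n)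

/-- Rounding up to the grid, as a self-map of `(0, ∞)`. -/
noncomputable def gridCeilPoint (z : ℕ → ℝ) (hpos : ∀ k, 0 < z k) (n : ℕ) (x : Ioi (0 : ℝ)) :
    Ioi (0 : ℝ) :=
  ⟨gridCeil z n x, gridCeil_pos hpos n x⟩

theorem measurableSet_gridCell (n k : ℕ) : MeasurableSet (gridCell z n k) :=
  measurable_subtype_coe measurableSet_Ioc

theorem measure_gridCell_lt_top (hpos : ∀ k, 0 < z k) (μ : LocFinMeasure (Ioi (0 : ℝ)))
    (n k : ℕ) : μ.1 (gridCell z n k) < ∞ :=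
  (measure_mono (preimage_mono Ioc_subset_Icc_self)).trans_lt
    (measure_preimage_Icc_lt_top μ (div_pos (hpos k) (hpos n)))

theorem eq_gridIndex_of_mem_gridCell (hpos : ∀ k, 0 < z k) (hmono : Monotone z)
    (hz : Tendsto z atTop atTop) {n k : ℕ} {x : Ioi (0 : ℝ)} (hx : x ∈ gridCell z n k) :
    k = gridIndex z (x * z n) :=
  (gridIndex_eq hz hmono ((div_lt_iff₀ (hpos n)).1 hx.1) ((le_div_iff₀ (hpos n)).1 hx.2)).symm

theorem mem_gridCell_gridIndex (hpos : ∀ k, 0 < z k) (hz : Tendsto z atTop atTop) {n : ℕ}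
    {x : Ioi (0 : ℝ)} (hx : z 0 < x * z n) : x ∈ gridCell z n (gridIndex z (x * z n)) :=
  ⟨(div_lt_iff₀ (hpos n)).2 (lt_of_lt_gridIndex hx), (le_div_iff₀ (hpos n)).2 (le_gridIndex hz _)⟩

/-- The rounded function is constant on each cell. Points left of all cells are rounded to `z 1 / z
n`, where `f` vanishes because of `hn`. -/
theorem comp_gridCeilPoint_eq_sum_indicator (hpos : ∀ k, 0 < z k) (hmono : Monotone z)
    (hz : Tendsto z atTop atTop) {f : Ioi (0 : ℝ) → ℝ} {a b : ℝ}
    (hf : ∀ x : Ioi (0 : ℝ), f x ≠ 0 → a ≤ x ∧ (x : ℝ) ≤ b) {n m : ℕ} (hn : z 1 / z n < a)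
    (hm : ∀ k, z (k + 1) / z n ≤ b ↔ k < m) (x : Ioi (0 : ℝ)) :
    f (gridCeilPoint z hpos n x) =
      ∑ k ∈ Finset.range m, (gridCell z n k).indicator (fun _ => f (gridPoint z hpos n k)) x := by
  rcases le_or_gt (x * z n) (z 0) with hx | hx
  · have h0 : f (gridCeilPoint z hpos n x) = 0 := by
      by_contra hne
      have h : a ≤ gridCeil z n x := (hf _ hne).1
      rw [gridCeil_eq_of_le hmono hx] at h
      exact absurd h (not_le.2 hn)
    rw [h0]
    refine (Finset.sum_eq_zero fun k _ => indicator_of_notMem (fun hk => ?_) _).symm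
    have h1 := (div_lt_iff₀ (hpos n)).1 hk.1
    have h2 := hmono k.zero_le
    linarith
  · have hmem := mem_gridCell_gridIndex hpos hz hx
    set j := gridIndex z (x * z n) with hj
    have hpt : gridCeilPoint z hpos n x = gridPoint z hpos n j := rfl
    rw [hpt]
    by_cases hjm : j < m
    · rw [Finset.sum_eq_single_of_mem j (Finset.mem_range.2 hjm), indicator_of_mem hmem]
      exact fun k _ hkj => indicator_of_notMem
        (fun hk => hkj (eq_gridIndex_of_mem_gridCell hpos hmono hz hk)) _
    · have h0 : f (gridPoint z hpos n j) = 0 := by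
        by_contra hne
        exact hjm ((hm j).1 (hf _ hne).2)
      rw [h0]
      refine (Finset.sum_eq_zero fun k hkm => indicator_of_notMem (fun hk => ?_) _).symm
      rw [eq_gridIndex_of_mem_gridCell hpos hmono hz hk] at hkm
      exact hjm (Finset.mem_range.1 hkm)

theorem integral_comp_gridCeilPoint (hpos : ∀ k, 0 < z k) (hmono : Monotone z)
    (hz : Tendsto z atTop atTop) {f : Ioi (0 : ℝ) → ℝ} {a b : ℝ}
    (hf : ∀ x : Ioi (0 : ℝ), f x ≠ 0 → a ≤ x ∧ (x : ℝ) ≤ b) {n m : ℕ} (hn : z 1 / z n < a)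
    (hm : ∀ k, z (k + 1) / z n ≤ b ↔ k < m) (μ : LocFinMeasure (Ioi (0 : ℝ))) :
    ∫ x, f (gridCeilPoint z hpos n x) ∂μ.1 =
      ∑ k ∈ Finset.range m, f (gridPoint z hpos n k) * (μ.1 (gridCell z n k)).toReal := by
  simp only [comp_gridCeilPoint_eq_sum_indicator hpos hmono hz hf hn hm]
  rw [integral_finsetSum]
  · refine Finset.sum_congr rfl fun k _ => ?_
    rw [integral_indicator_const _ (measurableSet_gridCell n k), smul_eq_mul, mul_comm]
    rfl
  · exact fun k _ => (integrable_indicator_iff (measurableSet_gridCell n k)).2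
      (integrableOn_const (measure_gridCell_lt_top hpos μ n k).ne)

theorem tendsto_integral_comp_gridCeilPoint (hpos : ∀ k, 0 < z k) (hmono : Monotone z)
    (hz : Tendsto z atTop atTop) (hratio : Tendsto (fun k => z (k + 1) / z k) atTop (𝓝 1))
    (f : C_c(Ioi (0 : ℝ), ℝ)) (μ : LocFinMeasure (Ioi (0 : ℝ))) :
    Tendsto (fun n => ∫ x, f (gridCeilPoint z hpos n x) ∂μ.1) atTop (𝓝 (∫ x, f x ∂μ.1)) := by
  obtain ⟨a, b, ha, hf⟩ := f.exists_support_subset_Icc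
  obtain ⟨R, hR1, hR⟩ := exists_ratio_le hratio
  obtain ⟨M, hM⟩ := f.hasCompactSupport.exists_bound_of_continuous f.continuous
  have hR0 : 0 < R := by linarith
  have hz1 : ∀ᶠ n in atTop, z 1 / z n < a :=
    (hz.const_div_atTop (z 1)).eventually_lt_const ha
  refine tendsto_integral_filter_of_dominated_convergence
    -- Rounding up multiplies by at most `R`, so a point rounded into `[a, b]` started in `[a / R,
    -- b]`.
    ((Subtype.val ⁻¹' Icc (a / R) b).indicator fun _ => M) ?_ ?_ ?_ ?_
  · refine Eventually.of_forall fun n => Measurable.aestronglyMeasurable ?_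
    exact f.continuous.measurable.comp
      (((measurable_gridCeil hz n).comp measurable_subtype_coe).subtype_mk)
  · filter_upwards [hz1] with n hn
    refine ae_of_all _ fun x => ?_
    by_cases hfx : f (gridCeilPoint z hpos n x) = 0
    · rw [hfx, norm_zero]
      exact indicator_nonneg (fun y _ => (norm_nonneg _).trans (hM y)) _
    · obtain ⟨h1, h2⟩ : a ≤ gridCeil z n x ∧ gridCeil z n x ≤ b := hf _ hfx
      have hx0 : z 0 < x * z n := by
        by_contra! hle
        rw [gridCeil_eq_of_le hmono hle] at h1
        exact absurd h1 (not_le.2 hn)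
      have hxR : gridCeil z n x ≤ R * x := by
        have hx : (0 : ℝ) < x := x.2
        refine (gridCeil_le_ratio_mul hpos hx0).trans ?_
        gcongr
        exact hR _
      rw [indicator_of_mem]
      · exact hM _
      · refine ⟨?_, (le_gridCeil hpos hz n x).trans h2⟩
        rw [div_le_iff₀ hR0, mul_comm]
        exact h1.trans hxR
  · refine (integrable_indicator_iff (measurable_subtype_coe measurableSet_Icc)).2
      (integrableOn_const (measure_preimage_Icc_lt_top μ (by positivity)).ne)
  · refine ae_of_all _ fun x => (f.continuous.tendsto x).comp ?_
    exact tendsto_subtype_rng.2 (tendsto_gridCeil hpos hmono hz hratio x.2)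

theorem integral_rescaledProcess {Ω : Type*} (hpos : ∀ k, 0 < z k) (hz : Tendsto z atTop atTop)
    (X : ℕ → Ω → ℕ) {f : Ioi (0 : ℝ) → ℝ} {a b : ℝ}
    (hf : ∀ x : Ioi (0 : ℝ), f x ≠ 0 → a ≤ x ∧ (x : ℝ) ≤ b) {n m : ℕ}
    (hm : ∀ k, z (k + 1) / z n ≤ b ↔ k < m) (ω : Ω) :
    ∫ x, f x ∂(rescaledProcess z hpos hz X n ω).1 =
      ∑ k ∈ Finset.range m, f (gridPoint z hpos n k) * X (k + 1) ω := by
  change ∫ x, f x ∂(Measure.sum fun k : ℕ => (X (k + 1) ω : ℝ≥0∞) •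
      Measure.dirac (gridPoint z hpos n k)) = _
  rw [integral_sum_dirac fun i => ENNReal.natCast_ne_top _, tsum_eq_sum (s := Finset.range m)]
  · refine Finset.sum_congr rfl fun k _ => ?_
    rw [ENNReal.toReal_natCast, smul_eq_mul, mul_comm]
  · intro k hk
    have : f (gridPoint z hpos n k) = 0 := by
      by_contra hne
      exact hk (Finset.mem_range.2 ((hm k).1 (hf _ hne).2))
    rw [this, smul_zero]

theorem measurable_rescaledProcess {Ω : Type*} [MeasurableSpace Ω] (hpos : ∀ k, 0 < z k)
    (hz : Tendsto z atTop atTop) {X : ℕ → Ω → ℕ} (hX : ∀ k, 1 ≤ k → Measurable (X k)) (n : ℕ) :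
    Measurable (rescaledProcess z hpos hz X n) := by
  have : LocallyCompactSpace (Ioi (0 : ℝ)) := isOpen_Ioi.locallyCompactSpace
  refine LocFinMeasure.measurable_of_measurable_apply fun B hB => ?_
  have : ∀ ω, (rescaledProcess z hpos hz X n ω).1 B =
      ∑' k, (X (k + 1) ω : ℝ≥0∞) * Measure.dirac (gridPoint z hpos n k) B := by
    intro ω
    change (Measure.sum fun k : ℕ => (X (k + 1) ω : ℝ≥0∞) •
      Measure.dirac (gridPoint z hpos n k)) B = _
    rw [Measure.sum_apply _ hB]
    rfl
  simp only [this]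
  refine Measurable.tsum fun k => ?_
  have := hX (k + 1) (Nat.le_add_left 1 k)
  exact Measurable.mul_const (by fun_prop) _

theorem IsPoissonProcess.measurable {S Ω : Type*} [TopologicalSpace S] [MeasurableSpace S]
    [T2Space S] [LocallyCompactSpace S] [SecondCountableTopology S] [OpensMeasurableSpace S]
    [MeasurableSpace Ω] {η : Ω → LocFinMeasure S} {Λ : Measure S} {P : Measure Ω}
    (h : IsPoissonProcess η Λ P) : Measurable η :=
  LocFinMeasure.measurable_of_measurable_apply h.measurable_count

/-- Disjoint cells carry independent Poisson(`l k`) counts, which yields a product to match factor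
by factor with that of `ν_n`. -/
theorem IsPoissonProcess.integral_exp_comp_gridCeilPoint {Ω : Type*} [MeasurableSpace Ω]
    {P : Measure Ω} {c : ℝ} (hc : 0 ≤ c)
    {η : Ω → LocFinMeasure (Ioi (0 : ℝ))} (hη : IsPoissonProcess η (scaleInvariantIntensity c) P)
    (hpos : ∀ k, 0 < z k) (hmono : Monotone z)
    (hz : Tendsto z atTop atTop) {f : Ioi (0 : ℝ) → ℝ} {a b : ℝ}
    (hf : ∀ x : Ioi (0 : ℝ), f x ≠ 0 → a ≤ x ∧ (x : ℝ) ≤ b) {n m : ℕ} (hn : z 1 / z n < a)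
    (hm : ∀ k, z (k + 1) / z n ≤ b ↔ k < m) :
    ∫ ω, Complex.exp ((∫ x, f (gridCeilPoint z hpos n x) ∂(η ω).1 : ℝ) * Complex.I) ∂P =
      ∏ k ∈ Finset.range m, Complex.exp (logIncrement c z k *
        (Complex.exp (f (gridPoint z hpos n k) * Complex.I) - 1)) := by
  have hmeas : ∀ k, Measurable fun ω => (η ω).1 (gridCell z n k) := fun k =>
    hη.measurable_count _ (measurableSet_gridCell n k)
  have hind : iIndepFun (fun (i : Fin m) ω => (η ω).1 (gridCell z n i)) P := by
    refine hη.indep_count m (fun i => gridCell z n i) (fun i => measurableSet_gridCell n i) ?_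
    refine fun i j hij => disjoint_left.2 fun x hi hj => hij (Fin.ext ?_)
    rw [eq_gridIndex_of_mem_gridCell hpos hmono hz hi,
      ← eq_gridIndex_of_mem_gridCell hpos hmono hz hj]
  have hind' := hind.comp (fun (i : Fin m) (y : ℝ≥0∞) => f (gridPoint z hpos n i) * y.toReal)
    fun i => by fun_prop
  simp only [integral_comp_gridCeilPoint hpos hmono hz hf hn hm, Finset.sum_range,
    Finset.prod_range]
  rw [integral_exp_sum_mul_I_eq_prod (Y := fun (i : Fin m) ω =>
    f (gridPoint z hpos n i) * ((η ω).1 (gridCell z n i)).toReal) (fun i => ?_) hind']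
  · refine Finset.prod_congr rfl fun i _ => ?_
    have hΛ : scaleInvariantIntensity c (gridCell z n i) =
        ENNReal.ofReal (logIncrement c z i) := by
      rw [gridCell, scaleInvariantIntensity_Ioc hc (div_pos (hpos _) (hpos n)), logIncrement,
        div_div_div_cancel_right₀ (hpos n).ne']
      have := (hpos n).le
      have := hmono (Nat.le_succ i)
      gcongr
    rw [integral_exp_mul_I_of_map_eq_poisson (hmeas i)
      (hη.poisson_count _ (measurableSet_gridCell n i) (by rw [hΛ]; exact ENNReal.ofReal_ne_top)),
      hΛ, ENNReal.ofReal, ENNReal.toNNReal_coe,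
      Real.coe_toNNReal _ (logIncrement_nonneg hc hpos hmono i)]
  · have := hmeas i
    exact Measurable.aemeasurable (by fun_prop)

theorem tendsto_charFun_poisson_comp_gridCeilPoint {Ω : Type*} [MeasurableSpace Ω]
    {P : Measure Ω} [IsProbabilityMeasure P] {η : Ω → LocFinMeasure (Ioi (0 : ℝ))}
    (hη : ∀ B, MeasurableSet B → Measurable fun ω => (η ω).1 B)
    (hpos : ∀ k, 0 < z k) (hmono : Monotone z) (hz : Tendsto z atTop atTop)
    (hratio : Tendsto (fun k => z (k + 1) / z k) atTop (𝓝 1)) (f : C_c(Ioi (0 : ℝ), ℝ)) :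
    Tendsto (fun n =>
        ∫ ω, Complex.exp ((∫ x, f (gridCeilPoint z hpos n x) ∂(η ω).1 : ℝ) * Complex.I) ∂P) atTop
      (𝓝 (∫ ω, Complex.exp ((∫ x, f x ∂(η ω).1 : ℝ) * Complex.I) ∂P)) := by
  obtain ⟨a, b, ha, hf⟩ := f.exists_support_subset_Icc
  refine tendsto_integral_filter_of_dominated_convergence (fun _ => 1) ?_ ?_
    (integrable_const _) (ae_of_all _ fun ω => ?_)
  · filter_upwards [(hz.const_div_atTop (z 1)).eventually_lt_const ha] with n hn
    obtain ⟨m, hm⟩ := exists_forall_grid_le_iff hpos hmono hz n b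
    simp only [integral_comp_gridCeilPoint hpos hmono hz hf hn hm]
    have := fun k => hη _ (measurableSet_gridCell (z := z) n k)
    exact Measurable.aestronglyMeasurable (by fun_prop)
  · exact Eventually.of_forall fun n => ae_of_all _ fun ω =>
      (Complex.norm_exp_ofReal_mul_I _).le
  · have h := tendsto_integral_comp_gridCeilPoint hpos hmono hz hratio f (η ω)
    have hcont : Continuous fun x : ℝ => Complex.exp (x * Complex.I) := by fun_prop
    exact (hcont.tendsto _).comp h

theorem tendsto_charFun_rescaledProcess_sub {Ω Ω' : Type*} [MeasurableSpace Ω]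
    {P : Measure Ω} [IsProbabilityMeasure P] [MeasurableSpace Ω'] {P' : Measure Ω'}
    {c : ℝ} (hc : 0 < c) (hpos : ∀ k, 0 < z k) (hmono : Monotone z) (hz : Tendsto z atTop atTop)
    (hratio : Tendsto (fun k => z (k + 1) / z k) atTop (𝓝 1)) {X : ℕ → Ω → ℕ}
    (hX : ∀ k, 1 ≤ k → Measurable (X k)) (hindep : iIndepFun (fun k => X (k + 1)) P)
    (hX0 : ∀ k, P.real {ω | X (k + 1) ω = 0} = Real.exp (-logIncrement c z k))
    (hX1 : ∀ k, P.real {ω | X (k + 1) ω = 1} =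
      Real.exp (-logIncrement c z k) * (1 - Real.exp (-logIncrement c z k)))
    {η : Ω' → LocFinMeasure (Ioi (0 : ℝ))} (hη : IsPoissonProcess η (scaleInvariantIntensity c) P')
    (f : C_c(Ioi (0 : ℝ), ℝ)) :
    Tendsto (fun n =>
        ∫ ω, Complex.exp ((∫ x, f x ∂(rescaledProcess z hpos hz X n ω).1 : ℝ) * Complex.I) ∂P -
        ∫ ω, Complex.exp ((∫ x, f (gridCeilPoint z hpos n x) ∂(η ω).1 : ℝ) * Complex.I) ∂P')
      atTop (𝓝 0) := by
  obtain ⟨a, b, ha, hf⟩ := f.exists_support_subset_Icc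
  obtain ⟨L, hL⟩ := (tendsto_logIncrement (c := c) hratio).bddAbove_range
  have hl0 := logIncrement_nonneg hc.le hpos hmono
  have hXm : ∀ k, Measurable (X (k + 1)) := fun k => hX _ (Nat.le_add_left 1 k)
  refine Metric.tendsto_atTop'.2 fun ε hε => ?_
  obtain ⟨N, hN⟩ := eventually_atTop.1 ((eventually_sum_logIncrement_mul_sqrt_le hc hpos hmono hz
    hratio b (ε := ε / 2 / (8 * √L / √a + 1)) (by positivity)).and
    ((hz.const_div_atTop (z 1)).eventually_lt_const ha))
  refine ⟨N, fun n hn => ?_⟩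
  obtain ⟨hsum, hn1⟩ := hN n hn.le
  obtain ⟨m, hm⟩ := exists_forall_grid_le_iff hpos hmono hz n b
  rw [hη.integral_exp_comp_gridCeilPoint hc.le hpos hmono hz hf hn1 hm, dist_zero_right]
  simp only [integral_rescaledProcess hpos hz X hf hm]
  rw [integral_exp_sum_mul_I_eq_prod
    (Y := fun k ω => f (gridPoint z hpos n k) * (X (k + 1) ω : ℝ))
    (fun k => by have := hXm k; exact Measurable.aemeasurable (by fun_prop))
    (hindep.comp (fun k (y : ℕ) => f (gridPoint z hpos n k) * (y : ℝ)) fun k => by fun_prop)]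
  refine (Finset.norm_prod_sub_prod_le _ (fun k _ => norm_integral_exp_mul_I_le_one _)
    fun k _ => norm_poisson_charFun_le_one (hl0 k) _).trans_lt ?_
  calc _ ≤ ∑ k ∈ Finset.range m, 8 * √L / √a *
        (logIncrement c z k * √(logIncrement c z k) * √(z (k + 1) / z n)) := by
        refine Finset.sum_le_sum fun k _ => ?_
        -- Factors with `f = 0` agree exactly. Otherwise the atom is at least `a`, so `8 * l ^ 2`
        -- can be traded for the summable quantity at the cost of `√L / √a`.
        by_cases hfk : f (gridPoint z hpos n k) = 0
        · have := div_pos (hpos (k + 1)) (hpos n)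
          have := hl0 k
          simp only [hfk, zero_mul, Complex.ofReal_zero, Complex.exp_zero, sub_self, mul_zero,
            integral_const, probReal_univ, one_smul, norm_zero]
          positivity
        · refine (norm_charFun_sub_poisson_le_sq (hXm k) (hl0 k) (hX0 k) (hX1 k) _).trans ?_
          have hy : a ≤ z (k + 1) / z n := (hf _ hfk).1
          have hlL : logIncrement c z k ≤ L := hL ⟨k, rfl⟩
          have h1 : 1 ≤ √(z (k + 1) / z n) / √a := by
            rw [one_le_div (Real.sqrt_pos.2 ha)]
            exact Real.sqrt_le_sqrt hy
          have h2 := Real.sqrt_le_sqrt hlL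
          have h3 := Real.mul_self_sqrt (hl0 k)
          have h0 := hl0 k
          calc 8 * logIncrement c z k ^ 2
              = 8 * logIncrement c z k * √(logIncrement c z k) * √(logIncrement c z k) * 1 := by
                linear_combination (-8 * logIncrement c z k) * h3
            _ ≤ 8 * logIncrement c z k * √(logIncrement c z k) * √L *
                (√(z (k + 1) / z n) / √a) := by gcongr
            _ = _ := by ring
    _ ≤ 8 * √L / √a * (ε / 2 / (8 * √L / √a + 1)) := by
        rw [← Finset.mul_sum]
        gcongr
        exact hsum m fun k hk => (hm k).2 hk
    _ < ε := by
        have h0 : 0 ≤ 8 * √L / √a := by positivity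
        rw [← mul_div_assoc, div_lt_iff₀ (by positivity)]
        nlinarith

theorem tendstoInDistribution_rescaledProcess {Ω Ω' : Type*} [MeasurableSpace Ω]
    {P : Measure Ω} [IsProbabilityMeasure P] [MeasurableSpace Ω'] {P' : Measure Ω'}
    [IsProbabilityMeasure P']
    {c : ℝ} (hc : 0 < c) (hpos : ∀ k, 0 < z k) (hmono : Monotone z) (hz : Tendsto z atTop atTop)
    (hratio : Tendsto (fun k => z (k + 1) / z k) atTop (𝓝 1)) {X : ℕ → Ω → ℕ}
    (hX : ∀ k, 1 ≤ k → Measurable (X k)) (hindep : iIndepFun (fun k => X (k + 1)) P)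
    (hX0 : ∀ k, P.real {ω | X (k + 1) ω = 0} = Real.exp (-logIncrement c z k))
    (hX1 : ∀ k, P.real {ω | X (k + 1) ω = 1} =
      Real.exp (-logIncrement c z k) * (1 - Real.exp (-logIncrement c z k)))
    {η : Ω' → LocFinMeasure (Ioi (0 : ℝ))}
    (hη : IsPoissonProcess η (scaleInvariantIntensity c) P') :
    TendstoInDistribution (rescaledProcess z hpos hz X) atTop η (fun _ => P) P' := by
  have : LocallyCompactSpace (Ioi (0 : ℝ)) := isOpen_Ioi.locallyCompactSpace
  refine LocFinMeasure.tendstoInDistribution_of_tendsto_charFun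
    (measurable_rescaledProcess hpos hz hX) hη.measurable fun f => ?_
  have h1 := tendsto_charFun_rescaledProcess_sub hc hpos hmono hz hratio hX hindep hX0 hX1 hη f
  have h2 := tendsto_charFun_poisson_comp_gridCeilPoint (P := P') hη.measurable_count hpos hmono hz hratio f
  simpa using h1.add h2

end PointProcess

/-! ### Riemann sums for `dv / v`. -/

section RiemannSums

theorem intervalIntegrable_inv_smul_of_norm_le_rpow {h : ℝ → ℂ} (hh : Measurable h) {A p : ℝ}
    (hp : 0 < p) (hb : ∀ v, 0 < v → ‖h v‖ ≤ A * v ^ p) {b : ℝ} (hb0 : 0 ≤ b) :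
    IntervalIntegrable (fun v : ℝ => v⁻¹ • h v) volume 0 b := by
  have h1 : IntervalIntegrable (fun v : ℝ => A * v ^ (p - 1)) volume 0 b :=
    (intervalIntegral.intervalIntegrable_rpow' (by linarith)).const_mul A
  refine h1.mono_fun' (Measurable.aestronglyMeasurable (by fun_prop)) ?_
  rw [uIoc_of_le hb0]
  refine (ae_restrict_iff' measurableSet_Ioc).2 (ae_of_all _ fun v hv => ?_)
  have hv0 : 0 < v := hv.1
  simp only [norm_smul, norm_inv, Real.norm_eq_abs, abs_of_pos hv0]
  calc v⁻¹ * ‖h v‖ ≤ v⁻¹ * (A * v ^ p) := by gcongr; exact hb v hv0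
    _ = A * v ^ (p - 1) := by rw [Real.rpow_sub_one hv0.ne']; ring

theorem sum_log_smul_eq_integral_gridCeil {z : ℕ → ℝ} (hpos : ∀ k, 0 < z k) (hmono : Monotone z)
    (hz : Tendsto z atTop atTop) (h : ℝ → ℂ) (n : ℕ) :
    ∑ k ∈ Finset.range n, Real.log (z (k + 1) / z k) • h (z (k + 1) / z n) =
      ∫ v in z 0 / z n..1, v⁻¹ • h (gridCeil z n v) := by
  have hapos : ∀ k, 0 < z k / z n := fun k => div_pos (hpos k) (hpos n)
  have hle : ∀ k, z k / z n ≤ z (k + 1) / z n := fun k => by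
    have := (hpos n).le
    have := hmono k.le_succ
    gcongr
  have hcongr : ∀ k, EqOn (fun v : ℝ => v⁻¹ • h (z (k + 1) / z n))
      (fun v => v⁻¹ • h (gridCeil z n v)) (Ioc (z k / z n) (z (k + 1) / z n)) := fun k v hv => by
    simp only [gridCeil_eq hpos hmono hz hv.1 hv.2]
  have hconst : ∀ k, IntervalIntegrable (fun v : ℝ => v⁻¹ • h (z (k + 1) / z n)) volume
      (z k / z n) (z (k + 1) / z n) := fun k => by
    refine ContinuousOn.intervalIntegrable ?_
    rw [uIcc_of_le (hle k)]
    exact (continuousOn_id.inv₀ fun v hv => ((hapos k).trans_le hv.1).ne').smul continuousOn_const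
  have hint : ∀ k, IntervalIntegrable (fun v => v⁻¹ • h (gridCeil z n v)) volume
      (z k / z n) (z (k + 1) / z n) := fun k => by
    refine (hconst k).congr ?_
    rw [uIoc_of_le (hle k)]
    exact hcongr k
  have hsum := intervalIntegral.sum_integral_adjacent_intervals (a := fun k => z k / z n) (n := n)
    fun k _ => hint k
  rw [div_self (hpos n).ne'] at hsum
  rw [← hsum]
  refine Finset.sum_congr rfl fun k _ => ?_
  rw [intervalIntegral.integral_of_le (hle k), ← setIntegral_congr_fun measurableSet_Ioc (hcongr k),
    ← intervalIntegral.integral_of_le (hle k), intervalIntegral.integral_smul_const,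
    integral_inv_of_pos (hapos k) (hapos (k + 1)), div_div_div_cancel_right₀ (hpos n).ne']

/-- Each logarithm is the integral of `v⁻¹` over a cell, so the sum is the integral of the rounded
function. The decay of `h` at `0` provides the integrable dominating function `A * R ^ p * v ^ (p -
1)`. -/
theorem tendsto_sum_log_smul {z : ℕ → ℝ} (hpos : ∀ k, 0 < z k) (hmono : Monotone z)
    (hz : Tendsto z atTop atTop) (hratio : Tendsto (fun k => z (k + 1) / z k) atTop (𝓝 1))
    {h : ℝ → ℂ} (hh : Continuous h) {A p : ℝ} (hA : 0 ≤ A) (hp : 0 < p)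
    (hb : ∀ v, 0 < v → ‖h v‖ ≤ A * v ^ p) :
    Tendsto (fun n => ∑ k ∈ Finset.range n, Real.log (z (k + 1) / z k) • h (z (k + 1) / z n))
      atTop (𝓝 (∫ v in (0 : ℝ)..1, v⁻¹ • h v)) := by
  obtain ⟨R, hR1, hR⟩ := exists_ratio_le hratio
  have hR0 : 0 < R := by linarith
  have hrw : ∀ n, ∑ k ∈ Finset.range n, Real.log (z (k + 1) / z k) • h (z (k + 1) / z n) =
      ∫ v in Ioc (0 : ℝ) 1, (Ioi (z 0 / z n)).indicator (fun v => v⁻¹ • h (gridCeil z n v)) v := by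
    intro n
    have h1 : z 0 / z n ≤ 1 := (div_le_one (hpos n)).2 (hmono n.zero_le)
    have h2 : 0 < z 0 / z n := div_pos (hpos 0) (hpos n)
    rw [sum_log_smul_eq_integral_gridCeil hpos hmono hz, intervalIntegral.integral_of_le h1,
      setIntegral_indicator measurableSet_Ioi, Ioc_inter_Ioi, max_eq_right h2.le]
  simp only [hrw]
  rw [intervalIntegral.integral_of_le zero_le_one]
  refine tendsto_integral_of_dominated_convergence (fun v => A * R ^ p * v ^ (p - 1)) ?_ ?_ ?_ ?_
  · intro n
    refine Measurable.aestronglyMeasurable (Measurable.indicator ?_ measurableSet_Ioi)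
    exact measurable_inv.smul (hh.measurable.comp (measurable_gridCeil hz n))
  · exact ((intervalIntegrable_iff_integrableOn_Ioc_of_le zero_le_one).1
      (intervalIntegral.intervalIntegrable_rpow' (by linarith))).const_mul _
  · intro n
    refine (ae_restrict_iff' measurableSet_Ioc).2 (ae_of_all _ fun v hv => ?_)
    have hv0 : 0 < v := hv.1
    by_cases hvn : v ∈ Ioi (z 0 / z n)
    · rw [indicator_of_mem hvn, norm_smul, norm_inv, Real.norm_eq_abs, abs_of_pos hv0]
      have hg := gridCeil_pos hpos n v
      have hgR : gridCeil z n v ≤ R * v := by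
        refine (gridCeil_le_ratio_mul hpos ((div_lt_iff₀ (hpos n)).1 hvn)).trans ?_
        gcongr
        exact hR _
      calc v⁻¹ * ‖h (gridCeil z n v)‖ ≤ v⁻¹ * (A * gridCeil z n v ^ p) := by
            gcongr; exact hb _ hg
        _ ≤ v⁻¹ * (A * (R * v) ^ p) := by gcongr
        _ = A * R ^ p * v ^ (p - 1) := by
            rw [Real.mul_rpow hR0.le hv0.le, Real.rpow_sub_one hv0.ne']; ring
    · rw [indicator_of_notMem hvn, norm_zero]
      positivity
  · refine (ae_restrict_iff' measurableSet_Ioc).2 (ae_of_all _ fun v hv => ?_)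
    have hv0 : 0 < v := hv.1
    have hlim := ((hh.tendsto v).comp (tendsto_gridCeil hpos hmono hz hratio hv0)).const_smul v⁻¹
    refine hlim.congr' ?_
    filter_upwards [(hz.const_div_atTop (z 0)).eventually_lt_const hv0] with n hn
    rw [indicator_of_mem (show v ∈ Ioi (z 0 / z n) from hn)]
    rfl

end RiemannSums

/-! ### The characteristic function of the Dickman law. -/

section Dickman

/-- The solution of `x χ(x) = ∫₀ˣ g χ` with `χ 0 = 1`. -/
theorem eq_exp_integral_of_mul_eq_integral {χ g : ℝ → ℂ} (hχ : Continuous χ) (hg : Continuous g)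
    (hχ0 : χ 0 = 1) {A p : ℝ} (hp : 0 < p) (hb : ∀ v, 0 < v → ‖g v - 1‖ ≤ A * v ^ p)
    (heq : ∀ x, 0 < x → x * χ x = ∫ v in (0 : ℝ)..x, g v * χ v) :
    χ 1 = Complex.exp (∫ v in (0 : ℝ)..1, v⁻¹ • (g v - 1)) := by
  set h : ℝ → ℂ := fun v => v⁻¹ • (g v - 1)
  have hint : ∀ x, 0 ≤ x → IntervalIntegrable h volume 0 x := fun x hx =>
    intervalIntegrable_inv_smul_of_norm_le_rpow (hg.sub continuous_const).measurable hp hb hx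
  set G : ℝ → ℂ := fun x => ∫ v in (0 : ℝ)..x, h v
  have hhm : Measurable h := measurable_inv.smul (hg.sub continuous_const).measurable
  have hG : ∀ x, 0 < x → HasDerivAt G (h x) x := fun x hx => by
    refine intervalIntegral.integral_hasDerivAt_right (hint x hx.le)
      hhm.stronglyMeasurable.stronglyMeasurableAtFilter ?_
    exact (continuousAt_inv₀ hx.ne').smul (hg.sub continuous_const).continuousAt
  -- Differentiating `x χ = ∫ g χ` gives `x χ' = (g - 1) χ`.
  have hχd : ∀ x, 0 < x → HasDerivAt χ (h x * χ x) x := fun x hx => by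
    have hx' : (x : ℂ) ≠ 0 := Complex.ofReal_ne_zero.2 hx.ne'
    have hH : HasDerivAt (fun x => ∫ v in (0 : ℝ)..x, g v * χ v) (g x * χ x) x :=
      ((hg.mul hχ).integral_hasStrictDerivAt 0 x).hasDerivAt
    have hdiv := hH.div (Complex.ofRealCLM.hasDerivAt (x := x)) hx'
    have heq' : χ =ᶠ[𝓝 x] fun y => (∫ v in (0 : ℝ)..y, g v * χ v) / Complex.ofRealCLM y := by
      filter_upwards [lt_mem_nhds hx] with y hy
      have hy' : (y : ℂ) ≠ 0 := Complex.ofReal_ne_zero.2 hy.ne'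
      rw [← heq y hy, Complex.ofRealCLM_apply, mul_div_cancel_left₀ _ hy']
    refine (hdiv.congr_of_eventuallyEq heq').congr_deriv ?_
    rw [← heq x hx]
    simp only [h, Complex.ofRealCLM_apply, Complex.real_smul, Complex.ofReal_inv,
      Complex.ofReal_one]
    field_simp
  -- The integrating factor makes `E` constant on `(0, 1]`; its limit at `0` identifies the constant
  -- as `1`.
  set E : ℝ → ℂ := fun x => χ x * Complex.exp (-G x)
  have hE : ∀ x, 0 < x → HasDerivAt E 0 x := fun x hx => by
    refine ((hχd x hx).mul (hG x hx).neg.cexp).congr_deriv ?_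
    ring
  have hconst : ∀ ε ∈ Ioc (0 : ℝ) 1, E ε = E 1 := fun ε hε => by
    refine (constant_of_has_deriv_right_zero (f := E) (a := ε) (b := 1) ?_ ?_ 1
      (right_mem_Icc.2 hε.2)).symm
    · exact fun x hx => (hE x (hε.1.trans_le hx.1)).continuousAt.continuousWithinAt
    · exact fun x hx => (hE x (hε.1.trans_le hx.1)).hasDerivWithinAt
  have hGc : ContinuousWithinAt G (Ioi 0) 0 := by
    have := intervalIntegral.continuousOn_primitive_interval' (hint 1 zero_le_one)
      (left_mem_uIcc)
    rw [uIcc_of_le zero_le_one] at this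
    exact ((this 0 (left_mem_Icc.2 zero_le_one)).mono_of_mem_nhdsWithin
      (mem_of_superset (Ioc_mem_nhdsGT zero_lt_one) Ioc_subset_Icc_self))
  have hEc : Tendsto E (𝓝[>] 0) (𝓝 (E 0)) :=
    hχ.continuousWithinAt.mul (Complex.continuous_exp.continuousAt.comp_continuousWithinAt hGc.neg)
  have hE0 : E 0 = 1 := by simp [E, G, hχ0]
  have hE1 : E 1 = 1 := by
    refine tendsto_nhds_unique ?_ (hE0 ▸ hEc)
    refine tendsto_const_nhds.congr' ?_
    filter_upwards [Ioc_mem_nhdsGT zero_lt_one] with ε hε using (hconst ε hε).symm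
  simp only [E, Complex.exp_neg] at hE1
  exact (mul_inv_eq_one₀ (Complex.exp_ne_zero _)).1 hE1

theorem norm_exp_rpow_mul_I_sub_one_le (s p : ℝ) {v : ℝ} (hv : 0 < v) :
    ‖Complex.exp ((s * v ^ p : ℝ) * Complex.I) - 1‖ ≤ |s| * v ^ p := by
  refine (norm_exp_mul_I_sub_one_le _).trans_eq ?_
  rw [abs_mul, abs_of_nonneg (Real.rpow_nonneg hv.le p)]

/-- The characteristic function of a generalized Dickman law. -/
theorem IsDickmanLaw.charFun_eq {c : ℝ} (hc : 0 < c) {D : Measure ℝ} [IsProbabilityMeasure D]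
    (hD : IsDickmanLaw c D) (s : ℝ) :
    charFun D s = Complex.exp (∫ v in (0 : ℝ)..1,
      v⁻¹ • (Complex.exp ((s * v ^ (1 / c) : ℝ) * Complex.I) - 1)) := by
  have hp : 0 < 1 / c := by positivity
  have hpow : Continuous fun v : ℝ => v ^ (1 / c) := Real.continuous_rpow_const hp.le
  have hφ : Continuous (charFun D) := continuous_charFun
  set g : ℝ → ℂ := fun v => Complex.exp ((s * v ^ (1 / c) : ℝ) * Complex.I) with hg
  set χ : ℝ → ℂ := fun v => charFun D (s * v ^ (1 / c)) with hχ
  have hfix : ∀ r : ℝ, charFun D r = ∫ u in (0 : ℝ)..1,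
      Complex.exp ((r * u ^ (1 / c) : ℝ) * Complex.I) * charFun D (r * u ^ (1 / c)) := by
    intro r
    have : IsProbabilityMeasure ((volume : Measure ℝ).restrict (Icc 0 1)) := ⟨by simp⟩
    conv_lhs => rw [← hD.fixedPoint]
    have hm : Measurable fun q : ℝ × ℝ => q.1 ^ (1 / c) * (q.2 + 1) := by fun_prop
    rw [charFun_apply_real, integral_map hm.aemeasurable (by fun_prop), integral_prod,
      intervalIntegral.integral_of_le zero_le_one, integral_Icc_eq_integral_Ioc]
    · refine integral_congr_ae (ae_of_all _ fun u => ?_)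
      simp only [charFun_apply_real]
      rw [← integral_const_mul]
      refine integral_congr_ae (ae_of_all _ fun w => ?_)
      simp only []
      rw [← Complex.exp_add]
      congr 1
      push_cast
      ring
    · refine Integrable.of_bound (C := 1) (Measurable.aestronglyMeasurable (by fun_prop))
        (ae_of_all _ fun q => ?_)
      rw [← Complex.ofReal_mul, Complex.norm_exp_ofReal_mul_I]
  have key := eq_exp_integral_of_mul_eq_integral (χ := χ) (g := g) (A := |s|) (p := 1 / c)
    (by fun_prop) (by fun_prop) (by
      simp only [hχ, Real.zero_rpow hp.ne', mul_zero, charFun_zero, probReal_univ,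
        Complex.ofReal_one]) hp
    (fun v hv => norm_exp_rpow_mul_I_sub_one_le s _ hv) ?_
  · simp only [hχ, Real.one_rpow, mul_one] at key
    exact key
  -- The fixed-point equation at `s * x ^ (1 / c)`, after the substitution `v = x u`, is the
  -- required integral equation.
  · intro x hx
    have hx' : (x : ℂ) ≠ 0 := Complex.ofReal_ne_zero.2 hx.ne'
    have hsub := intervalIntegral.smul_integral_comp_mul_left (a := 0) (b := 1)
      (fun v => g v * χ v) x
    rw [mul_zero, mul_one] at hsub
    rw [← hsub, Complex.real_smul]
    congr 1
    simp only [hχ, hg]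
    rw [hfix]
    refine intervalIntegral.integral_congr fun u hu => ?_
    rw [uIcc_of_le zero_le_one] at hu
    simp only [Real.mul_rpow hx.le hu.1, mul_assoc]

end Dickman

/-! ### Convergence of the weighted sums. -/

section WeightedSums

variable {z : ℕ → ℝ}

/-- Passing to `z ^ c` absorbs the factor `c` into the logarithms; the exponent `1 / c` in the
integrand undoes the change. -/
theorem tendsto_prod_poisson_charFun {c : ℝ} (hc : 0 < c) (hpos : ∀ k, 0 < z k)
    (hmono : Monotone z) (hz : Tendsto z atTop atTop)
    (hratio : Tendsto (fun k => z (k + 1) / z k) atTop (𝓝 1)) (s : ℝ) :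
    Tendsto (fun n => ∏ k ∈ Finset.range n, Complex.exp (logIncrement c z k *
        (Complex.exp ((s * (z (k + 1) / z n) : ℝ) * Complex.I) - 1))) atTop
      (𝓝 (Complex.exp (∫ v in (0 : ℝ)..1,
        v⁻¹ • (Complex.exp ((s * v ^ (1 / c) : ℝ) * Complex.I) - 1)))) := by
  have hp : 0 < 1 / c := by positivity
  have hpow : Continuous fun v : ℝ => v ^ (1 / c) := Real.continuous_rpow_const hp.le
  have hlim := tendsto_sum_log_smul (z := fun k => z k ^ c)
    (h := fun v => Complex.exp ((s * v ^ (1 / c) : ℝ) * Complex.I) - 1) (A := |s|) (p := 1 / c)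
    (fun k => Real.rpow_pos_of_pos (hpos k) c)
    (fun i j hij => Real.rpow_le_rpow (hpos i).le (hmono hij) hc.le)
    ((tendsto_rpow_atTop hc).comp hz)
    (by
      have := hratio.rpow_const (p := c) (Or.inl one_ne_zero)
      rw [Real.one_rpow] at this
      exact this.congr fun k => Real.div_rpow (hpos _).le (hpos _).le c)
    (by fun_prop) (abs_nonneg s) hp (fun v hv => norm_exp_rpow_mul_I_sub_one_le s _ hv)
  refine ((Complex.continuous_exp.tendsto _).comp hlim).congr fun n => ?_
  rw [Function.comp_apply, Complex.exp_sum]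
  refine Finset.prod_congr rfl fun k _ => ?_
  have hk := hpos k
  have hk1 := hpos (k + 1)
  rw [← Real.div_rpow hk1.le hk.le, Real.log_rpow (div_pos hk1 hk),
    ← Real.div_rpow hk1.le (hpos n).le, ← Real.rpow_mul (div_pos hk1 (hpos n)).le,
    mul_one_div_cancel hc.ne', Real.rpow_one, Complex.real_smul, logIncrement]

variable {Ω : Type*} [MeasurableSpace Ω] {P : Measure Ω} [IsProbabilityMeasure P]

theorem tendsto_charFun_mul_zero {Y : Ω → ℕ} (hY : Measurable Y) {r : ℕ → ℝ}
    (hr : Tendsto r atTop (𝓝 0)) :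
    Tendsto (fun n => ∫ ω, Complex.exp ((r n * Y ω : ℝ) * Complex.I) ∂P) atTop (𝓝 1) := by
  have h1 : ∫ _ : Ω, (1 : ℂ) ∂P = 1 := by simp
  rw [← h1]
  refine tendsto_integral_of_dominated_convergence (fun _ => 1)
    (fun n => Measurable.aestronglyMeasurable (by fun_prop)) (integrable_const _)
    (fun n => ae_of_all _ fun ω => (Complex.norm_exp_ofReal_mul_I _).le)
    (ae_of_all _ fun ω => ?_)
  have hcont : Continuous fun x : ℝ => Complex.exp ((x * Y ω : ℝ) * Complex.I) := by fun_prop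
  have h0 := (hcont.tendsto 0).comp hr
  rw [zero_mul, Complex.ofReal_zero, zero_mul, Complex.exp_zero] at h0
  exact h0

theorem tendsto_charFun_weighted_sum_sub_prod {c : ℝ} (hc : 0 < c) (hpos : ∀ k, 0 < z k)
    (hmono : Monotone z) (hz : Tendsto z atTop atTop)
    (hratio : Tendsto (fun k => z (k + 1) / z k) atTop (𝓝 1)) {X : ℕ → Ω → ℕ}
    (hX : ∀ k, Measurable (X k)) (hindep : iIndepFun X P)
    (hX0 : ∀ k, P.real {ω | X k ω = 0} = Real.exp (-logIncrement c z k))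
    (hX1 : ∀ k, P.real {ω | X k ω = 1} =
      Real.exp (-logIncrement c z k) * (1 - Real.exp (-logIncrement c z k)))
    {C : ℝ} (hC : 0 ≤ C)
    (hEX : ∀ᶠ k in atTop, ∫⁻ ω, (X k ω : ℝ≥0∞) ∂P ≤ ENNReal.ofReal (C * logIncrement c z k))
    (s : ℝ) :
    Tendsto (fun n =>
        ∫ ω, Complex.exp ((∑ k ∈ Finset.range n, s * (z (k + 1) / z n) * X k ω : ℝ) *
          Complex.I) ∂P -
        ∏ k ∈ Finset.range n, Complex.exp (logIncrement c z k *
          (Complex.exp ((s * (z (k + 1) / z n) : ℝ) * Complex.I) - 1))) atTop (𝓝 0) := by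
  have hl0 := logIncrement_nonneg hc.le hpos hmono
  set d : ℕ → ℕ → ℝ := fun n k =>
    ‖∫ ω, Complex.exp ((s * (z (k + 1) / z n) * X k ω : ℝ) * Complex.I) ∂P -
      Complex.exp (logIncrement c z k *
        (Complex.exp ((s * (z (k + 1) / z n) : ℝ) * Complex.I) - 1))‖ with hd
  obtain ⟨N, hN⟩ := eventually_atTop.1 (hEX.and
    ((tendsto_logIncrement (c := c) hratio).eventually_le_const (by norm_num : (0 : ℝ) < 1 / 2)))
  -- `K` comes from multiplying the quadratic and the linear bound for `d n k` and taking the square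
  -- root.
  set K := √(8 * (C + 2) * |s|)
  have hdK : ∀ n k, N ≤ k → d n k ≤
      K * (logIncrement c z k * √(logIncrement c z k) * √(z (k + 1) / z n)) := by
    intro n k hk
    have hy := (div_pos (hpos (k + 1)) (hpos n)).le
    have hl := hl0 k
    have h1 : d n k ≤ 8 * logIncrement c z k ^ 2 :=
      norm_charFun_sub_poisson_le_sq (hX k) (hl0 k) (hX0 k) (hX1 k) _
    have h2 : d n k ≤ (C + 2) * logIncrement c z k * |s * (z (k + 1) / z n)| :=
      norm_charFun_sub_poisson_le_mul (hX k) (hl0 k) (hN k hk).2 hC (hN k hk).1 _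
    rw [abs_mul, abs_of_nonneg hy] at h2
    have hd0 : 0 ≤ d n k := norm_nonneg _
    refine le_of_sq_le_sq ?_ (by positivity)
    have hK : K ^ 2 = 8 * (C + 2) * |s| := Real.sq_sqrt (by positivity)
    calc d n k ^ 2 = d n k * d n k := sq _
      _ ≤ 8 * logIncrement c z k ^ 2 *
          ((C + 2) * logIncrement c z k * (|s| * (z (k + 1) / z n))) := by gcongr
      _ = _ := by
          rw [mul_pow, mul_pow, mul_pow, hK, Real.sq_sqrt hl, Real.sq_sqrt hy]; ring
  -- The mean bound holds only from `N` on; each of the finitely many earlier terms vanishes because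
  -- its weight tends to `0`.
  have hinit : Tendsto (fun n => ∑ k ∈ Finset.range N, d n k) atTop (𝓝 0) := by
    have : ∀ k, Tendsto (fun n => d n k) atTop (𝓝 0) := by
      intro k
      have hr : Tendsto (fun n => s * (z (k + 1) / z n)) atTop (𝓝 0) := by
        simpa using (hz.const_div_atTop (z (k + 1))).const_mul s
      have ha := tendsto_charFun_mul_zero (P := P) (hX k) hr
      have hcont : Continuous fun x : ℝ => Complex.exp (logIncrement c z k *
        (Complex.exp (x * Complex.I) - 1)) := by fun_prop
      have hb := (hcont.tendsto 0).comp hr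
      rw [Complex.ofReal_zero, zero_mul, Complex.exp_zero, sub_self, mul_zero,
        Complex.exp_zero] at hb
      have h := (ha.sub hb).norm
      rw [sub_self, norm_zero] at h
      exact h
    simpa using tendsto_finsetSum (Finset.range N) fun k _ => this k
  have htail : Tendsto (fun n => ∑ k ∈ Finset.range n,
      logIncrement c z k * √(logIncrement c z k) * √(z (k + 1) / z n)) atTop (𝓝 0) := by
    refine Metric.tendsto_nhds.2 fun ε hε => ?_
    filter_upwards [eventually_sum_logIncrement_mul_sqrt_le hc hpos hmono hz hratio 1
      (half_pos hε)] with n hn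
    have h0 : 0 ≤ ∑ k ∈ Finset.range n,
        logIncrement c z k * √(logIncrement c z k) * √(z (k + 1) / z n) :=
      Finset.sum_nonneg fun k _ => by have := hl0 k; positivity
    rw [Real.dist_0_eq_abs, abs_of_nonneg h0]
    have := hn n fun k hk => (div_le_one (hpos n)).2 (hmono hk)
    linarith
  have hbound := hinit.add (htail.const_mul K)
  rw [mul_zero, add_zero] at hbound
  refine squeeze_zero_norm (fun n => ?_) hbound
  rw [integral_exp_sum_mul_I_eq_prod (Y := fun k ω => s * (z (k + 1) / z n) * (X k ω : ℝ))
    (fun k => by have := hX k; exact Measurable.aemeasurable (by fun_prop))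
    (hindep.comp (fun k (y : ℕ) => s * (z (k + 1) / z n) * (y : ℝ)) fun k => by fun_prop)]
  refine (Finset.norm_prod_sub_prod_le _ (fun k _ => norm_integral_exp_mul_I_le_one _)
    fun k _ => norm_poisson_charFun_le_one (hl0 k) _).trans ?_
  calc ∑ k ∈ Finset.range n, d n k
      ≤ ∑ k ∈ Finset.range n, ((if k < N then d n k else 0) +
        K * (logIncrement c z k * √(logIncrement c z k) * √(z (k + 1) / z n))) := by
        refine Finset.sum_le_sum fun k _ => ?_
        have h0 : 0 ≤ K * (logIncrement c z k * √(logIncrement c z k) * √(z (k + 1) / z n)) := by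
          have := hl0 k; positivity
        split_ifs with hk
        · linarith
        · linarith [hdK n k (not_lt.1 hk)]
    _ ≤ _ := by
        rw [Finset.sum_add_distrib, ← Finset.mul_sum, ← Finset.sum_filter]
        gcongr ?_ + _
        refine Finset.sum_le_sum_of_subset_of_nonneg (fun k hk => ?_) fun k _ _ => norm_nonneg _
        exact Finset.mem_range.2 (Finset.mem_filter.1 hk).2

theorem tendstoInDistribution_weighted_sum {c : ℝ} (hc : 0 < c) (hpos : ∀ k, 0 < z k)
    (hmono : Monotone z) (hz : Tendsto z atTop atTop)
    (hratio : Tendsto (fun k => z (k + 1) / z k) atTop (𝓝 1)) {X : ℕ → Ω → ℕ}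
    (hX : ∀ k, Measurable (X k)) (hindep : iIndepFun X P)
    (hX0 : ∀ k, P.real {ω | X k ω = 0} = Real.exp (-logIncrement c z k))
    (hX1 : ∀ k, P.real {ω | X k ω = 1} =
      Real.exp (-logIncrement c z k) * (1 - Real.exp (-logIncrement c z k)))
    {C : ℝ} (hC : 0 ≤ C)
    (hEX : ∀ᶠ k in atTop, ∫⁻ ω, (X k ω : ℝ≥0∞) ∂P ≤ ENNReal.ofReal (C * logIncrement c z k))
    {D : Measure ℝ} [IsProbabilityMeasure D] (hD : IsDickmanLaw c D) :
    TendstoInDistribution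
      (fun (n : ℕ) ω => ∑ k ∈ Finset.range n, z (k + 1) / z n * (X k ω : ℝ))
      atTop id (fun _ => P) D := by
  have hm : ∀ n, Measurable fun ω => ∑ k ∈ Finset.range n, z (k + 1) / z n * (X k ω : ℝ) :=
    fun n => by fun_prop
  refine ⟨fun n => (hm n).aemeasurable, aemeasurable_id, ?_⟩
  refine ProbabilityMeasure.tendsto_of_tendsto_charFun fun s => ?_
  simp only [ProbabilityMeasure.coe_mk, Measure.map_id]
  rw [hD.charFun_eq hc]
  have h := (tendsto_charFun_weighted_sum_sub_prod hc hpos hmono hz hratio hX hindep hX0 hX1 hC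
    hEX s).add (tendsto_prod_poisson_charFun hc hpos hmono hz hratio s)
  simp only [sub_add_cancel, zero_add] at h
  refine h.congr fun n => ?_
  rw [charFun_apply_real, integral_map (hm n).aemeasurable (by fun_prop)]
  simp only [mul_assoc, ← Finset.mul_sum, Complex.ofReal_mul]

end WeightedSums

theorem theorem3p3
    {Ω : Type*} [MeasurableSpace Ω] (P : Measure Ω) [IsProbabilityMeasure P]
    (c : ℝ) (hc : 0 < c)
    (z : ℕ → ℝ) (hpos : ∀ k, 0 < z k) (hmono : Monotone z) (hz : Tendsto z atTop atTop)
    (hratio : Tendsto (fun k => z (k + 1) / z k) atTop (𝓝 1))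
    (X : ℕ → Ω → ℕ) (hX : ∀ k, 1 ≤ k → Measurable (X k))
    (hindep : iIndepFun (fun k => X (k + 1)) P)
    (hX0 : ∀ k, 1 ≤ k → P.real {ω | X k ω = 0} = (z (k - 1) / z k) ^ c)
    (hX1 : ∀ k, 1 ≤ k → P.real {ω | X k ω = 1} =
      P.real {ω | X k ω = 0} * (1 - P.real {ω | X k ω = 0})) :
    (∀ {Ω' : Type*} [MeasurableSpace Ω'] (P' : Measure Ω') [IsProbabilityMeasure P']
      (η : Ω' → LocFinMeasure (Ioi (0 : ℝ))),
      IsPoissonProcess η (scaleInvariantIntensity c) P' →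
        TendstoInDistribution (rescaledProcess z hpos hz X) atTop η (fun _ => P) P') ∧
    ((∃ C : ℝ≥0, ∀ᶠ k in atTop,
        ∫⁻ ω, (X k ω : ℝ≥0∞) ∂P ≤ C * P {ω | X k ω = 1}) →
      ∀ (D : Measure ℝ) [IsProbabilityMeasure D], IsDickmanLaw c D →
        TendstoInDistribution
          (fun (n : ℕ) (ω : Ω) => (1 / z n) * ∑ k ∈ Finset.Icc 1 n, z k * (X k ω : ℝ))
          atTop id (fun _ => P) D) := by
  have h0 : ∀ k, P.real {ω | X (k + 1) ω = 0} = Real.exp (-logIncrement c z k) := fun k => by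
    rw [hX0 (k + 1) (Nat.le_add_left 1 k), exp_neg_logIncrement hpos, Nat.add_sub_cancel]
  have h1 : ∀ k, P.real {ω | X (k + 1) ω = 1} =
      Real.exp (-logIncrement c z k) * (1 - Real.exp (-logIncrement c z k)) := fun k => by
    rw [hX1 (k + 1) (Nat.le_add_left 1 k), h0]
  refine ⟨fun P' _ η hη => tendstoInDistribution_rescaledProcess hc hpos hmono hz hratio hX hindep
    h0 h1 hη, ?_⟩
  rintro ⟨C, hC⟩ D _ hD
  -- `q (1 - q) ≤ 1 - q ≤ l` for `q = exp (-l)` turns the mean condition into a bound linear in `l`.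
  have hEX : ∀ᶠ k in atTop,
      ∫⁻ ω, (X (k + 1) ω : ℝ≥0∞) ∂P ≤ ENNReal.ofReal (C * logIncrement c z k) := by
    filter_upwards [(tendsto_add_atTop_nat 1).eventually hC] with k hk
    refine hk.trans ?_
    rw [ENNReal.ofReal_mul C.coe_nonneg, ENNReal.ofReal_coe_nnreal]
    gcongr
    rw [← ofReal_measureReal, h1]
    refine ENNReal.ofReal_le_ofReal ?_
    have hl := logIncrement_nonneg hc.le hpos hmono k
    have hq := Real.add_one_le_exp (-logIncrement c z k)
    have hq1 : Real.exp (-logIncrement c z k) ≤ 1 := Real.exp_le_one_iff.2 (by linarith)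
    nlinarith [Real.exp_pos (-logIncrement c z k)]
  have h := tendstoInDistribution_weighted_sum hc hpos hmono hz hratio
    (fun k => hX (k + 1) (Nat.le_add_left 1 k)) hindep h0 h1 C.coe_nonneg hEX hD
  convert h using 3 with n ω
  rw [← Finset.Ico_add_one_right_eq_Icc, Finset.sum_Ico_eq_sum_range, Finset.mul_sum,
    Nat.add_sub_cancel]
  refine Finset.sum_congr rfl fun k _ => ?_
  rw [add_comm 1 k]
  ring
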